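/- Let $\mathfrak g=\mathfrak{sl}_2(\mathbb C)$ with standard basis $f,h,e$, and let $\mathfrak T=\mathfrak g\otimes\mathbb C[x]/(x^2)$ be the Takiff $\mathfrak{sl}_2$, a complex Lie algebra with bracket $[v\otimes a,w\otimes b]=[v,w]\otimes ab$. Identify $\mathfrak g$ with $\mathfrak g\otimes 1$, and write $\bar v=v\otimes x$ and $\bar{\mathfrak g}=\mathfrak g\otimes x$. A $\mathfrak T$-module is called a $\mathfrak g$-Harish-Chandra module if its restriction to $\mathfrak g$ is a direct sum of simple finite-dimensional $\mathfrak g$-modules, each isomorphism class occurring with finite multiplicity. Put $\bar C=\bar h^2+4\bar f\bar e$, a central element of $U(\mathfrak T)$. Let $Q(0)=U(\mathfrak T)\otimes_{U(\mathfrak g)}\mathbb C$ be the module induced from the trivial $\mathfrak g$-module, and for $\chi\in\mathbb C$ let $Q(0,\chi)=Q(0)/(\bar C-\chi)Q(0)$. **Theorem.** (1) For every infinite-dimensional simple $\mathfrak g$-Harish-Chandra $\mathfrak T$-module $V$, $\operatorname{Ext}^1(V,V)\cong\mathbb C$ as complex vector spaces, where $\operatorname{Ext}^1$ is taken in the category of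 $U(\mathfrak T)$-modules. (2) Let $\chi\in\mathbb C\setminus\{0\}$. Regard $U(\bar{\mathfrak g})$ as a $\mathfrak T$-module on which $\mathfrak g$ acts by the adjoint action and $\bar{\mathfrak g}$ by left multiplication. Then there is a non-split short exact sequence of $\mathfrak T$-modules $$0\to Q(0,\chi)\to U(\bar{\mathfrak g})/(\bar C-\chi)^2\to Q(0,\chi)\to 0,$$ and for every non-split short exact sequence $0\to Q(0,\chi)\to M\to Q(0,\chi)\to 0$ of $\mathfrak T$-modules, $M\cong U(\bar{\mathfrak g})/(\bar C-\chi)^2$ as $\mathfrak T$-modules. -/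

import Mathlib

open scoped TensorProduct

noncomputable section

namespace TakiffSl2

/-! ### The Takiff Lie algebra of `𝔰𝔩₂` -/

/-- The Lie algebra `𝔤 = 𝔰𝔩₂(ℂ)` of traceless complex `2 × 2` matrices. -/
def Sl2 : Type := LieAlgebra.SpecialLinear.sl (Fin 2) ℂ

instance : LieRing Sl2 := inferInstanceAs (LieRing (LieAlgebra.SpecialLinear.sl (Fin 2) ℂ))

instance : LieAlgebra ℂ Sl2 :=
  inferInstanceAs (LieAlgebra ℂ (LieAlgebra.SpecialLinear.sl (Fin 2) ℂ))

/-- The Takiff Lie algebra `𝔗 = 𝔤 ⊗ ℂ[x]/(x²)`, a Lie algebra over `ℂ` with bracket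
`[v ⊗ a, w ⊗ b] = [v, w] ⊗ ab` (in the code the factor `ℂ[x]/(x²)` stands on the left). -/
def Takiff : Type := DualNumber ℂ ⊗[ℂ] Sl2

instance : LieRing Takiff := inferInstanceAs (LieRing (DualNumber ℂ ⊗[ℂ] Sl2))

instance : LieAlgebra ℂ Takiff := inferInstanceAs (LieAlgebra ℂ (DualNumber ℂ ⊗[ℂ] Sl2))

/-- The element `v ⊗ a` of `𝔗`. -/
def tens (a : DualNumber ℂ) : Sl2 →ₗ[ℂ] Takiff := TensorProduct.mk ℂ (DualNumber ℂ) Sl2 a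

lemma tens_lie (a b : DualNumber ℂ) (v w : Sl2) :
    ⁅tens a v, tens b w⁆ = tens (a * b) ⁅v, w⁆ := rfl

/-- The inclusion `𝔤 → 𝔗`, `v ↦ v ⊗ 1`. -/
def incl : Sl2 →ₗ⁅ℂ⁆ Takiff where
  toLinearMap := tens 1
  map_lie' := by
    intro v w
    change tens 1 ⁅v, w⁆ = ⁅tens 1 v, tens 1 w⁆
    rw [tens_lie, one_mul]

/-- The linear map `𝔤 → 𝔗`, `v ↦ v̄ = v ⊗ x`. -/
def bar : Sl2 →ₗ[ℂ] Takiff := tens DualNumber.eps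

/-- The component `v` of the element `v ⊗ 1 + w ⊗ x` of `𝔗`. -/
def even : Takiff →ₗ[ℂ] Sl2 :=
  TensorProduct.lift (LinearMap.lsmul ℂ Sl2 ∘ₗ (TrivSqZeroExt.fstHom ℂ ℂ ℂ).toLinearMap)

/-- The component `w` of the element `v ⊗ 1 + w ⊗ x` of `𝔗`. -/
def odd : Takiff →ₗ[ℂ] Sl2 :=
  TensorProduct.lift (LinearMap.lsmul ℂ Sl2 ∘ₗ TrivSqZeroExt.sndHom ℂ ℂ)

lemma even_tens (a : DualNumber ℂ) (v : Sl2) : even (tens a v) = a.fst • v := rfl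

lemma odd_tens (a : DualNumber ℂ) (v : Sl2) : odd (tens a v) = a.snd • v := rfl

lemma takiff_induction {P : Takiff → Prop} (zero : P 0) (tmul : ∀ a v, P (tens a v))
    (add : ∀ x y, P x → P y → P (x + y)) (t : Takiff) : P t :=
  TensorProduct.induction_on t zero tmul add

lemma even_lie (s t : Takiff) : even ⁅s, t⁆ = ⁅even s, even t⁆ := by
  induction s using takiff_induction with
  | zero => simp
  | add x y hx hy => simp [hx, hy]
  | tmul a v =>
    induction t using takiff_induction with
    | zero => simp
    | add x y hx hy => simp [hx, hy]
    | tmul b w =>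
      simp only [tens_lie, even_tens, TrivSqZeroExt.fst_mul, mul_smul, smul_lie, lie_smul]
      rw [smul_comm]

lemma odd_lie (s t : Takiff) : odd ⁅s, t⁆ = ⁅even s, odd t⁆ + ⁅odd s, even t⁆ := by
  induction s using takiff_induction with
  | zero => simp
  | add x y hx hy => simp only [add_lie, map_add, hx, hy]; abel
  | tmul a v =>
    induction t using takiff_induction with
    | zero => simp
    | add x y hx hy => simp only [lie_add, map_add, hx, hy]; abel
    | tmul b w =>
      simp only [tens_lie, even_tens, odd_tens, smul_lie, lie_smul, smul_smul, ← add_smul]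
      congr 1
      simp [mul_comm]

/-- The subalgebra `𝔤 = 𝔤 ⊗ 1` of `𝔗`. -/
def gSub : LieSubalgebra ℂ Takiff := incl.range

/-! ### Harish-Chandra modules and extensions -/

/-- A `𝔗`-module is a `𝔤`-Harish-Chandra module if its restriction to `𝔤` is the (internal) direct
sum of a family `𝒮` of simple finite-dimensional `𝔤`-submodules, in which each isomorphism class
occurs only finitely often. -/
def IsHarishChandra (V : Type*) [AddCommGroup V] [Module ℂ V] [LieRingModule Takiff V]
    [LieModule ℂ Takiff V] : Prop :=
  ∃ 𝒮 : Set (LieSubmodule ℂ gSub V),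
    sSupIndep 𝒮 ∧ sSup 𝒮 = ⊤ ∧
    (∀ S ∈ 𝒮, LieModule.IsIrreducible ℂ gSub S ∧ FiniteDimensional ℂ S) ∧
    ∀ S ∈ 𝒮, {S' ∈ 𝒮 | Nonempty (S ≃ₗ⁅ℂ, gSub⁆ S')}.Finite

/-- The universal enveloping algebra `U(𝔗)`. -/
abbrev U : Type := UniversalEnvelopingAlgebra ℂ Takiff

/-- A `𝔗`-module, regarded as an object of the category of all (left) `U(𝔗)`-modules. -/
def toModuleCat (V : Type*) [AddCommGroup V] [Module ℂ V] [LieRingModule Takiff V]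
    [LieModule ℂ Takiff V] : ModuleCat U :=
  letI : Module U V :=
    Module.compHom V (UniversalEnvelopingAlgebra.lift ℂ (LieModule.toEnd ℂ Takiff V)).toRingHom
  ModuleCat.of U V

section Sequences

variable {V M W : Type*}
  [AddCommGroup V] [Module ℂ V] [LieRingModule Takiff V] [LieModule ℂ Takiff V]
  [AddCommGroup M] [Module ℂ M] [LieRingModule Takiff M] [LieModule ℂ Takiff M]
  [AddCommGroup W] [Module ℂ W] [LieRingModule Takiff W] [LieModule ℂ Takiff W]

/-- `0 → V → M → W → 0` is a short exact sequence of `𝔗`-modules. -/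
def IsShortExact (i : V →ₗ⁅ℂ, Takiff⁆ M) (p : M →ₗ⁅ℂ, Takiff⁆ W) : Prop :=
  Function.Injective i ∧ Function.Exact i p ∧ Function.Surjective p

/-- The epimorphism `p` of `𝔗`-modules (or the short exact sequence which it ends) splits. -/
def IsSplit (p : M →ₗ⁅ℂ, Takiff⁆ W) : Prop :=
  ∃ s : W →ₗ⁅ℂ, Takiff⁆ M, ∀ w, p (s w) = w

end Sequences

/-! ### Elements of `U(𝔗)` -/

/-- The standard basis element `f` of `𝔰𝔩₂`. -/
def f : Sl2 := LieAlgebra.SpecialLinear.single (1 : Fin 2) 0 (by decide) (1 : ℂ)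

/-- The standard basis element `h` of `𝔰𝔩₂`. -/
def h : Sl2 := LieAlgebra.SpecialLinear.singleSubSingle (0 : Fin 2) 1 (1 : ℂ)

/-- The standard basis element `e` of `𝔰𝔩₂`. -/
def e : Sl2 := LieAlgebra.SpecialLinear.single (0 : Fin 2) 1 (by decide) (1 : ℂ)

/-- The image in `U(𝔗)` of an element `v` of `𝔤`. -/
def uIncl (v : Sl2) : U := UniversalEnvelopingAlgebra.ι ℂ (incl v)

/-- The image in `U(𝔗)` of `v̄`, for an element `v` of `𝔤`. -/
def uBar (v : Sl2) : U := UniversalEnvelopingAlgebra.ι ℂ (bar v)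

/-- `C̄ = h̄² + 4 f̄ ē`, the generator of the purely Takiff part of the center of `U(𝔗)`. -/
def Cbar : U := uBar h ^ 2 + 4 * (uBar f * uBar e)

/-- The algebra `U(𝔤̄)`, as the subalgebra of `U(𝔗)` generated by `𝔤̄ = 𝔤 ⊗ x`. -/
def UBar : Subalgebra ℂ U := Algebra.adjoin ℂ (Set.range uBar)

lemma uIncl_add (a b : Sl2) : uIncl (a + b) = uIncl a + uIncl b := by simp [uIncl]

lemma uIncl_smul (c : ℂ) (a : Sl2) : uIncl (c • a) = c • uIncl a := by simp [uIncl]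

lemma uBar_add (a b : Sl2) : uBar (a + b) = uBar a + uBar b := by simp [uBar]

lemma uBar_smul (c : ℂ) (a : Sl2) : uBar (c • a) = c • uBar a := by simp [uBar]

attribute [local instance 100] LieRing.ofAssociativeRing in
lemma iota_lie (s t : Takiff) : (UniversalEnvelopingAlgebra.ι ℂ ⁅s, t⁆ : U) =
    UniversalEnvelopingAlgebra.ι ℂ s * UniversalEnvelopingAlgebra.ι ℂ t -
      UniversalEnvelopingAlgebra.ι ℂ t * UniversalEnvelopingAlgebra.ι ℂ s := by
  rw [LieHom.map_lie, LieRing.of_associative_ring_bracket]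

lemma uIncl_lie (a b : Sl2) : uIncl ⁅a, b⁆ = uIncl a * uIncl b - uIncl b * uIncl a := by
  rw [uIncl, LieHom.map_lie, iota_lie]; rfl

lemma uBar_lie (a b : Sl2) : uBar ⁅a, b⁆ = uIncl a * uBar b - uBar b * uIncl a := by
  have : bar ⁅a, b⁆ = ⁅incl a, bar b⁆ := by
    change tens _ ⁅a, b⁆ = ⁅tens _ a, tens _ b⁆
    rw [tens_lie, one_mul]
  rw [uBar, this, iota_lie]; rfl

lemma uBar_lie' (a b : Sl2) : uBar ⁅a, b⁆ = uBar a * uIncl b - uIncl b * uBar a := by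
  rw [← lie_skew, ← neg_one_smul ℂ, uBar_smul, uBar_lie]; simp

lemma uBar_comm (a b : Sl2) : uBar a * uBar b = uBar b * uBar a := by
  have h1 : ⁅bar a, bar b⁆ = 0 := by
    change ⁅tens _ a, tens _ b⁆ = 0
    rw [tens_lie, DualNumber.eps_mul_eps]
    exact TensorProduct.zero_tmul _ _
  have h2 := iota_lie (bar a) (bar b)
  rw [h1, map_zero] at h2
  exact sub_eq_zero.mp h2.symm

lemma uBar_mem (b : Sl2) : uBar b ∈ UBar := Algebra.subset_adjoin ⟨b, rfl⟩

lemma Cbar_mem : Cbar ∈ UBar :=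
  add_mem (pow_mem (uBar_mem _) 2) (mul_mem (ofNat_mem UBar 4) (mul_mem (uBar_mem _) (uBar_mem _)))

lemma commutator_mem (a : Sl2) {u : U} (hu : u ∈ UBar) : uIncl a * u - u * uIncl a ∈ UBar := by
  induction hu using Algebra.adjoin_induction with
  | mem x hx =>
    obtain ⟨b, rfl⟩ := hx
    rw [← uBar_lie]; exact uBar_mem _
  | algebraMap r => rw [Algebra.commutes, sub_self]; exact zero_mem _
  | add x y _ _ hx hy =>
    have : uIncl a * (x + y) - (x + y) * uIncl a =
      (uIncl a * x - x * uIncl a) + (uIncl a * y - y * uIncl a) := by noncomm_ring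
    rw [this]; exact add_mem hx hy
  | mul x y hx' hy' hx hy =>
    have : uIncl a * (x * y) - (x * y) * uIncl a =
      (uIncl a * x - x * uIncl a) * y + x * (uIncl a * y - y * uIncl a) := by noncomm_ring
    rw [this]; exact add_mem (mul_mem hx hy') (mul_mem hx' hy)

lemma sl2_decomp (a : Sl2) : ∃ x y z : ℂ, a = x • f + y • h + z • e := by
  obtain ⟨m, hm⟩ := a
  refine ⟨m 1 0, m 0 0, m 0 1, Subtype.ext ?_⟩
  have ht : m 0 0 + m 1 1 = 0 := by
    have : m.trace = 0 := hm
    rwa [Matrix.trace_fin_two] at this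
  change m = m 1 0 • Matrix.single 1 0 1 + m 0 0 • (Matrix.single 0 0 1 - Matrix.single 1 1 1)
    + m 0 1 • Matrix.single 0 1 1
  ext i j
  fin_cases i <;> fin_cases j <;> simp [eq_neg_of_add_eq_zero_right ht]

lemma lie_h_e : ⁅h, e⁆ = (2 : ℂ) • e := by
  apply Subtype.ext
  change (Matrix.single 0 0 1 - Matrix.single 1 1 1) * Matrix.single 0 1 1 -
    Matrix.single 0 1 1 * (Matrix.single 0 0 1 - Matrix.single 1 1 1) =
    (2 : ℂ) • (Matrix.single 0 1 1 : Matrix (Fin 2) (Fin 2) ℂ)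
  ext i j
  fin_cases i <;> fin_cases j <;> simp [Matrix.mul_apply]; norm_num

lemma lie_h_f : ⁅h, f⁆ = (-2 : ℂ) • f := by
  apply Subtype.ext
  change (Matrix.single 0 0 1 - Matrix.single 1 1 1) * Matrix.single 1 0 1 -
    Matrix.single 1 0 1 * (Matrix.single 0 0 1 - Matrix.single 1 1 1) =
    (-2 : ℂ) • (Matrix.single 1 0 1 : Matrix (Fin 2) (Fin 2) ℂ)
  ext i j
  fin_cases i <;> fin_cases j <;> simp [Matrix.mul_apply]; norm_num

lemma lie_e_f : ⁅e, f⁆ = h := by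
  apply Subtype.ext
  change (Matrix.single 0 1 1 : Matrix (Fin 2) (Fin 2) ℂ) * Matrix.single 1 0 1 -
    Matrix.single 1 0 1 * Matrix.single 0 1 1 = Matrix.single 0 0 1 - Matrix.single 1 1 1
  ext i j
  fin_cases i <;> fin_cases j <;> simp

/-- `C̄` commutes with `𝔤`. -/
lemma Cbar_comm (a : Sl2) : uIncl a * Cbar = Cbar * uIncl a := by
  have hc : ∀ a : Sl2, uIncl a * Cbar = Cbar * uIncl a + (uBar h * uBar ⁅a, h⁆
      + uBar ⁅a, h⁆ * uBar h + 4 * (uBar f * uBar ⁅a, e⁆ + uBar ⁅a, f⁆ * uBar e)) := by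
    intro a; simp only [uBar_lie, Cbar]; noncomm_ring
  have z : uBar 0 = 0 := by simp [uBar]
  have hfh : ⁅f, h⁆ = (2 : ℂ) • f := by rw [← lie_skew, lie_h_f]; simp
  have heh : ⁅e, h⁆ = (-2 : ℂ) • e := by rw [← lie_skew, lie_h_e]; simp
  have hfe : ⁅f, e⁆ = (-1 : ℂ) • h := by rw [← lie_skew, lie_e_f]; simp
  have h4 : (4 : U) = algebraMap ℂ U 4 := (map_ofNat (algebraMap ℂ U) 4).symm
  have hf : uIncl f * Cbar = Cbar * uIncl f := by
    rw [hc, hfh, hfe, lie_self, z, uBar_smul, uBar_smul, h4, ← Algebra.smul_def,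
      mul_smul_comm, mul_smul_comm, smul_mul_assoc, uBar_comm h f]
    simp only [zero_mul]
    module
  have hh : uIncl h * Cbar = Cbar * uIncl h := by
    rw [hc, lie_self, z, lie_h_e, lie_h_f, uBar_smul, uBar_smul, h4, ← Algebra.smul_def,
      mul_smul_comm, smul_mul_assoc]
    simp only [mul_zero, zero_mul]
    module
  have he : uIncl e * Cbar = Cbar * uIncl e := by
    rw [hc, heh, lie_e_f, lie_self, z, uBar_smul, h4, ← Algebra.smul_def,
      mul_smul_comm, smul_mul_assoc, uBar_comm h e]
    simp only [mul_zero]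
    module
  obtain ⟨x, y, w, rfl⟩ := sl2_decomp a
  simp only [uIncl_add, uIncl_smul, add_mul, mul_add, smul_mul_assoc, mul_smul_comm, hf, hh, he]

lemma UBar_mul_comm {u v : U} (hu : u ∈ UBar) (hv : v ∈ UBar) : u * v = v * u := by
  refine Algebra.commute_of_mem_adjoin_of_forall_mem_commute hv fun b hb => ?_
  refine (Algebra.commute_of_mem_adjoin_of_forall_mem_commute hu fun b' hb' => ?_).symm
  obtain ⟨x, rfl⟩ := hb
  obtain ⟨y, rfl⟩ := hb'
  exact uBar_comm x y

/-! ### The `𝔗`-module `U(𝔤̄)` and its quotients -/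

/-- The `𝔗`-module structure on `U(𝔤̄)`: `𝔤` acts by the adjoint action `v ∘ u = v u - u v`, and
`𝔤̄` by left multiplication `w̄ ∘ u = w̄ u`. -/
instance : LieRingModule Takiff UBar where
  bracket t u := ⟨uIncl (even t) * u - u * uIncl (even t) + uBar (odd t) * u,
    add_mem (commutator_mem _ u.2) (mul_mem (uBar_mem _) u.2)⟩
  add_lie s t u := by
    ext; simp only [map_add, uIncl_add, uBar_add, AddMemClass.coe_add]; noncomm_ring
  lie_add s u v := by
    ext; simp only [AddMemClass.coe_add]; noncomm_ring
  leibniz_lie s t u := by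
    ext
    have h3 : uBar (odd s) * (uBar (odd t) * (u : U)) = uBar (odd t) * (uBar (odd s) * u) := by
      rw [← mul_assoc, uBar_comm, mul_assoc]
    simp only [even_lie, odd_lie, uIncl_lie, uBar_add, uBar_lie (even s), uBar_lie' (odd s),
      AddMemClass.coe_add]
    simp only [mul_add, add_mul, mul_sub, sub_mul, mul_assoc, h3]
    abel

lemma coe_lie (t : Takiff) (u : UBar) : ((⁅t, u⁆ : UBar) : U) =
    uIncl (even t) * u - u * uIncl (even t) + uBar (odd t) * u := rfl

instance : LieModule ℂ Takiff UBar where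
  smul_lie c t u := by
    ext; simp [coe_lie, uIncl_smul, uBar_smul, smul_sub]
  lie_smul c t u := by
    ext; simp [coe_lie, smul_sub]

/-- The ideal of the (commutative) algebra `U(𝔤̄)` generated by `(C̄ - χ)ᵏ`, that is
`{(C̄ - χ)ᵏ u | u ∈ U(𝔤̄)}`, as a `𝔗`-submodule. -/
def powIdeal (χ : ℂ) (k : ℕ) : LieSubmodule ℂ Takiff UBar where
  toSubmodule :=
    LinearMap.range (LinearMap.mulLeft ℂ ((⟨Cbar, Cbar_mem⟩ - algebraMap ℂ UBar χ) ^ k))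
  lie_mem := by
    rintro t _ ⟨u, rfl⟩
    refine ⟨⁅t, u⁆, ?_⟩
    have hx (a : Sl2) : Commute (uIncl a) ((Cbar - algebraMap ℂ U χ) ^ k) :=
      Commute.pow_right (Commute.sub_right (Cbar_comm a) (Algebra.commutes χ _).symm) k
    have hy (b : Sl2) : Commute (uBar b) ((Cbar - algebraMap ℂ U χ) ^ k) :=
      UBar_mul_comm (uBar_mem b) (pow_mem (sub_mem Cbar_mem (UBar.algebraMap_mem χ)) k)
    ext
    change (Cbar - algebraMap ℂ U χ) ^ k *
        (uIncl (even t) * u - u * uIncl (even t) + uBar (odd t) * u) =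
      uIncl (even t) * ((Cbar - algebraMap ℂ U χ) ^ k * u)
        - (Cbar - algebraMap ℂ U χ) ^ k * u * uIncl (even t)
        + uBar (odd t) * ((Cbar - algebraMap ℂ U χ) ^ k * u)
    rw [mul_add, mul_sub, ← mul_assoc (uIncl _), (hx _).eq, ← mul_assoc (uBar _), (hy _).eq]
    simp only [mul_assoc]

/-- The `𝔗`-module `U(𝔤̄) / (C̄ - χ)²`. -/
abbrev UBarModSq (χ : ℂ) : Type := UBar ⧸ powIdeal χ 2

/-! ### The universal module `Q(0, χ)` -/

/-- The induced module `Q(0) = U(𝔗) ⊗_{U(𝔤)} L(0)` of the trivial module, that is, the quotient of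
`U(𝔗)` by the left ideal generated by `𝔤`. -/
abbrev Q0 : Type := U ⧸ Submodule.span U (Set.range uIncl)

/-- The submodule `(C̄ - χ) Q(0)` of `Q(0)`. -/
def Q0Sub (χ : ℂ) : Submodule U Q0 :=
  Submodule.span U (Set.range fun w : Q0 => (Cbar - algebraMap ℂ U χ) • w)

/-- The universal module `Q(0, χ) = Q(0) / (C̄ - χ) Q(0)`. -/
def Qchi (χ : ℂ) : Type := Q0 ⧸ Q0Sub χ

instance (χ : ℂ) : AddCommGroup (Qchi χ) := inferInstanceAs (AddCommGroup (Q0 ⧸ Q0Sub χ))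

instance (χ : ℂ) : Module U (Qchi χ) := inferInstanceAs (Module U (Q0 ⧸ Q0Sub χ))

instance (χ : ℂ) : Module ℂ (Qchi χ) := Module.compHom _ (algebraMap ℂ U)

lemma smul_Qchi (χ c : ℂ) (w : Qchi χ) : c • w = algebraMap ℂ U c • w := rfl

instance (χ : ℂ) : LieRingModule Takiff (Qchi χ) where
  bracket t w := UniversalEnvelopingAlgebra.ι ℂ t • w
  add_lie s t w := by
    rw [map_add, add_smul]
  lie_add s u w := smul_add _ _ _
  leibniz_lie s t w := by
    change _ • (_ • w) = UniversalEnvelopingAlgebra.ι ℂ ⁅s, t⁆ • w + _ • (_ • w)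
    rw [iota_lie, sub_smul, mul_smul, mul_smul, sub_add_cancel]

lemma lie_Qchi (χ : ℂ) (t : Takiff) (w : Qchi χ) :
    ⁅t, w⁆ = (UniversalEnvelopingAlgebra.ι ℂ t : U) • w := rfl

instance (χ : ℂ) : LieModule ℂ Takiff (Qchi χ) where
  smul_lie c t w := by
    simp only [lie_Qchi, smul_Qchi, map_smul, Algebra.smul_def, mul_smul]
  lie_smul c t w := by
    simp only [lie_Qchi, smul_Qchi, ← mul_smul, Algebra.commutes]

end TakiffSl2

end

/-! *Part (1).* An infinite-dimensional simple Harish-Chandra module `V` is spanned by the vectors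
`fʲ ēᵏ v` for a highest weight vector `v`, and central elements act by scalars, `C̄` by some
`χ ≠ 0`. From `0 → Ann v → U(𝔗) → V → 0`, `Ext¹(V, V)` is `Hom(Ann v, V)` modulo the maps
`k ↦ k • x`. Up to these, a homomorphism `φ` is determined by `φ (C̄ - χ)`, a multiple of `v`: if
`φ` kills `C̄ - χ`, then `C̄` acts by `χ` on the extension defined by `φ`, and the lift of `v` can
be corrected to a highest weight vector satisfying all the relations of `v`. The derivation of
`U(𝔗)` extending `v + w̄ ↦ w̄` provides a `φ` with `φ (C̄ - χ) = 2 χ v ≠ 0`.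

*Part (2).* `U(𝔤̄)` is a polynomial ring and `Q(0, χ) ≅ U(𝔤̄)/(C̄ - χ)`. In a self-extension of
`Q(0, χ)` the generator lifts to a `𝔤`-invariant vector `m`, and `(C̄ - χ) m` is a multiple `a` of
the generator of the submodule. If `a = 0`, then `m` splits the extension; otherwise `m` generates
it and its annihilator in `U(𝔤̄)` is generated by `(C̄ - χ)²`. -/

noncomputable section

namespace TakiffSl2

section Eigenspaces

variable {K M : Type*} [Field K] [AddCommGroup M] [Module K M]

lemma isCompl_eigenspace_range {A : Module.End K M} (hA : ⨆ ν, A.eigenspace ν = ⊤) (μ : K) :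
    IsCompl (A.eigenspace μ) (LinearMap.range (A - algebraMap K _ μ)) := by
  have apply_eq {ν : K} {x : M} (hx : x ∈ A.eigenspace ν) :
      (A - algebraMap K (Module.End K M) μ) x = (ν - μ) • x := by
    rw [LinearMap.sub_apply, Module.End.mem_eigenspace_iff.mp hx, Module.algebraMap_end_apply,
      sub_smul]
  constructor
  · refine (A.eigenspaces_iSupIndep μ).mono_right ?_
    rw [LinearMap.range_eq_map, ← hA, Submodule.map_iSup]
    refine iSup_le fun ν => ?_
    rintro _ ⟨x, hx, rfl⟩
    rw [apply_eq hx]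
    rcases eq_or_ne ν μ with rfl | hν
    · rw [sub_self, zero_smul]; exact zero_mem _
    · exact Submodule.smul_mem _ _ (Submodule.mem_iSup_of_mem ν (Submodule.mem_iSup_of_mem hν hx))
  · refine codisjoint_iff_le_sup.mpr (hA.ge.trans (iSup_le fun ν => ?_))
    rcases eq_or_ne ν μ with rfl | hν
    · exact le_sup_left
    · refine le_sup_of_le_right fun x hx => ⟨(ν - μ)⁻¹ • x, ?_⟩
      rw [map_smul, apply_eq hx, inv_smul_smul₀ (sub_ne_zero.mpr hν)]

lemma mem_span_of_eigenvector {ι : Type*} {A : Module.End K M} {b : ι → M} {ev : ι → K}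
    (hb : ∀ i, b i ∈ A.eigenspace (ev i)) {x : M} (hx : x ∈ Submodule.span K (Set.range b)) {μ : K}
    (hμ : x ∈ A.eigenspace μ) : x ∈ Submodule.span K (b '' {i | ev i = μ}) := by
  have hsplit : Set.range b = b '' {i | ev i = μ} ∪ b '' {i | ev i ≠ μ} := by
    rw [← Set.image_union, ← Set.image_univ]
    congr 1
    ext i
    simp [em]
  rw [hsplit, Submodule.span_union] at hx
  obtain ⟨y, hy, z, hz, rfl⟩ := Submodule.mem_sup.mp hx
  have hy' : y ∈ A.eigenspace μ := Submodule.span_le.mpr (by rintro _ ⟨i, rfl, rfl⟩; exact hb i) hy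
  have hz' : z ∈ ⨆ (ν) (_ : ν ≠ μ), A.eigenspace ν := by
    refine Submodule.span_le.mpr ?_ hz
    rintro _ ⟨i, hi, rfl⟩
    exact Submodule.mem_iSup_of_mem (ev i) (Submodule.mem_iSup_of_mem hi (hb i))
  have hz0 : z = 0 := Submodule.disjoint_def.mp (A.eigenspaces_iSupIndep μ) z
    ((add_mem_cancel_left hy').mp hμ) hz'
  rwa [hz0, add_zero]

end Eigenspaces

section LocallyNilpotent

variable {K M N P : Type*} [CommRing K] [AddCommGroup M] [Module K M] [AddCommGroup N] [Module K N]
  [AddCommGroup P] [Module K P]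

/-- An endomorphism `A` is locally nilpotent if every vector is killed by some power of `A`. -/
def IsLocallyNilpotent (A : Module.End K M) : Prop :=
  ∀ x, ∃ p, (A ^ p) x = 0

lemma isLocallyNilpotent_of_span {A : Module.End K M} {S : Set M} (hS : Submodule.span K S = ⊤)
    (h : ∀ x ∈ S, ∃ p, (A ^ p) x = 0) : IsLocallyNilpotent A := by
  have hle : Submodule.span K S ≤ A.maxGenEigenspace 0 := Submodule.span_le.mpr fun x hx => by
    simpa [Module.End.mem_maxGenEigenspace] using h x hx
  intro x
  simpa [Module.End.mem_maxGenEigenspace] using hle (hS ▸ Submodule.mem_top : x ∈ _)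

lemma map_pow_apply_of_map_apply {A : Module.End K M} {B : Module.End K N} {φ : M →ₗ[K] N}
    (hφ : ∀ x, φ (A x) = B (φ x)) (k : ℕ) (x : M) : φ ((A ^ k) x) = (B ^ k) (φ x) := by
  induction k generalizing x with
  | zero => rfl
  | succ k ih => rw [pow_succ, pow_succ, Module.End.mul_apply, Module.End.mul_apply, ih, hφ]

lemma IsLocallyNilpotent.of_exact {A : Module.End K M} {B : Module.End K N} {C : Module.End K P}
    {i : M →ₗ[K] N} {p : N →ₗ[K] P} (hi : ∀ x, i (A x) = B (i x)) (hp : ∀ x, p (B x) = C (p x))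
    (hip : Function.Exact i p) (hA : IsLocallyNilpotent A) (hC : IsLocallyNilpotent C) :
    IsLocallyNilpotent B := by
  intro x
  obtain ⟨k, hk⟩ := hC (p x)
  rw [← map_pow_apply_of_map_apply hp] at hk
  obtain ⟨y, hy⟩ := (hip _).mp hk
  obtain ⟨l, hl⟩ := hA y
  refine ⟨l + k, ?_⟩
  rw [pow_add, Module.End.mul_apply, ← hy, ← map_pow_apply_of_map_apply hi, hl, map_zero]

end LocallyNilpotent

/-- A representation of `𝔰𝔩₂` over `K`, given by the operators by which the standard basis acts.
Unlike in Mathlib's `IsSl2Triple`, the operator `hOp` may vanish, as it does on trivial modules. -/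
class Sl2Module (K : outParam Type*) (M : Type*) [CommRing K] [AddCommGroup M] [Module K M] where
  eOp : M →ₗ[K] M
  fOp : M →ₗ[K] M
  hOp : M →ₗ[K] M
  e_f (m : M) : eOp (fOp m) = fOp (eOp m) + hOp m
  h_e (m : M) : hOp (eOp m) = eOp (hOp m) + (2 : K) • eOp m
  h_f (m : M) : hOp (fOp m) = fOp (hOp m) - (2 : K) • fOp m

open Sl2Module

section CommRing

variable {K M N : Type*} [CommRing K] [AddCommGroup M] [Module K M] [Sl2Module K M]
  [AddCommGroup N] [Module K N] [Sl2Module K N]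

/-- A homomorphism of representations of `𝔰𝔩₂`. -/
structure IsSl2Hom (φ : M →ₗ[K] N) : Prop where
  map_e (x : M) : φ (eOp x) = eOp (φ x)
  map_f (x : M) : φ (fOp x) = fOp (φ x)
  map_h (x : M) : φ (hOp x) = hOp (φ x)

lemma h_f_pow (k : ℕ) (x : M) :
    hOp ((fOp ^ k) x) = (fOp ^ k) (hOp x) - (2 * k : K) • (fOp ^ k) x := by
  induction k with
  | zero => simp
  | succ k ih =>
    simp only [pow_succ', Module.End.mul_apply, h_f, ih, map_sub, map_smul]
    push_cast
    module

lemma e_f_pow (m : M) (k : ℕ) : eOp ((fOp ^ (k + 1)) m) =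
    (fOp ^ (k + 1)) (eOp m) + (k + 1 : K) • (fOp ^ k) (hOp m - (k : K) • m) := by
  induction k with
  | zero => simp [e_f]
  | succ k ih =>
    rw [pow_succ' _ (k + 1), Module.End.mul_apply, e_f, ih, h_f_pow]
    simp only [pow_succ', Module.End.mul_apply, map_sub, map_smul, map_add]
    push_cast
    module

/-- The operator `(h + 1)² + 4fe`, a multiple of the usual Casimir operator shifted by a constant so
that its value on highest weight vectors of weight `μ` is `(μ + 1)²`. -/
def casimir : M →ₗ[K] M := (hOp + 1) * (hOp + 1) + (4 : K) • (fOp * eOp)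

lemma casimir_apply (m : M) :
    casimir m = hOp (hOp m) + (2 : K) • hOp m + m + (4 : K) • fOp (eOp m) := by
  simp only [casimir, LinearMap.add_apply, Module.End.mul_apply, Module.End.one_apply,
    LinearMap.smul_apply, map_add]
  module

lemma casimir_f (m : M) : casimir (fOp m) = fOp (casimir m) := by
  simp only [casimir_apply, map_add, map_smul, map_sub, h_f, e_f]
  module

/-- `w` is zero or a highest weight vector of weight `μ`. -/
structure IsHighest (w : M) (μ : K) : Prop where
  e : eOp w = 0
  h : hOp w = μ • w

namespace IsHighest

variable {w : M} {μ : K}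

lemma h_pow (hw : IsHighest w μ) (j : ℕ) : hOp ((fOp ^ j) w) = (μ - 2 * j) • (fOp ^ j) w := by
  rw [h_f_pow, hw.h, map_smul, sub_smul]

lemma e_pow (hw : IsHighest w μ) (j : ℕ) :
    eOp ((fOp ^ (j + 1)) w) = ((j + 1) * (μ - j)) • (fOp ^ j) w := by
  rw [e_f_pow, hw.e, hw.h, map_zero, zero_add, ← sub_smul, map_smul, smul_smul]

lemma casimir_pow (hw : IsHighest w μ) (j : ℕ) :
    casimir ((fOp ^ j) w) = (μ + 1) ^ 2 • (fOp ^ j) w := by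
  induction j with
  | zero =>
    simp only [pow_zero, Module.End.one_apply, casimir_apply, hw.e, hw.h, map_smul, map_zero]
    module
  | succ j ih => rw [pow_succ', Module.End.mul_apply, casimir_f, ih, map_smul]

lemma map {φ : M →ₗ[K] N} (hφ : IsSl2Hom φ) (hw : IsHighest w μ) : IsHighest (φ w) μ :=
  ⟨by rw [← hφ.map_e, hw.e, map_zero], by rw [← hφ.map_h, hw.h, map_smul]⟩

lemma of_map {φ : M →ₗ[K] N} (hφ : IsSl2Hom φ) (hinj : Function.Injective φ) {x : M}
    (hx : IsHighest (φ x) μ) : IsHighest x μ :=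
  ⟨hinj (by rw [hφ.map_e, hx.e, map_zero]), hinj (by rw [hφ.map_h, hx.h, map_smul])⟩

end IsHighest

/-- A vector `fʲ w` with `j ≤ n`, where `w` is of highest weight `n` and `fⁿ⁺¹ w = 0`. -/
def IsStringVector (x : M) : Prop :=
  ∃ (w : M) (n j : ℕ), IsHighest w (n : K) ∧ (fOp ^ (n + 1)) w = 0 ∧ j ≤ n ∧ x = (fOp ^ j) w

variable (M) in
/-- `M` is a sum of simple finite-dimensional representations of `𝔰𝔩₂`. -/
def IsStringSpanned : Prop :=
  Submodule.span K {x : M | IsStringVector x} = ⊤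

lemma IsStringSpanned.isLocallyNilpotent_f (hM : IsStringSpanned M) :
    IsLocallyNilpotent (fOp : M →ₗ[K] M) := by
  refine isLocallyNilpotent_of_span hM ?_
  rintro _ ⟨w, n, j, -, h0, -, rfl⟩
  refine ⟨n + 1, ?_⟩
  rw [← Module.End.mul_apply, ← pow_add]
  exact Module.End.pow_map_zero_of_le (Nat.le_add_right _ _) h0

end CommRing

section Field

variable {K M : Type*} [Field K] [CharZero K] [AddCommGroup M] [Module K M] [Sl2Module K M]

namespace IsHighest

variable {w : M} {μ : K}

lemma pow_eq_zero_of_pow_succ (hw : IsHighest w μ) {k : ℕ} (hk : μ ≠ k)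
    (h : (fOp ^ (k + 1)) w = 0) : (fOp ^ k) w = 0 := by
  have hcoef := hw.e_pow k
  rw [h, map_zero] at hcoef
  exact (smul_eq_zero.mp hcoef.symm).resolve_left
    (mul_ne_zero (Nat.cast_add_one_ne_zero k) (sub_ne_zero.mpr hk))

lemma pow_eq_zero (hw : IsHighest w μ) {a p : ℕ} (hap : a ≤ p) (hμ : ∀ k < p, a ≤ k → μ ≠ k)
    (hp : (fOp ^ p) w = 0) : (fOp ^ a) w = 0 :=
  Nat.decreasingInduction' (P := fun k => (fOp ^ k) w = 0)
    (fun k hkp hak => hw.pow_eq_zero_of_pow_succ (hμ k hkp hak)) hap hp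

lemma eq_zero_of_forall_ne_natCast (hw : IsHighest w μ) (hμ : ∀ k : ℕ, μ ≠ k)
    (hp : ∃ p, (fOp ^ p) w = 0) : w = 0 := by
  obtain ⟨p, hp⟩ := hp
  exact hw.pow_eq_zero p.zero_le (fun k _ _ => hμ k) hp

variable {n : ℕ}

lemma eq_zero_of_pow (hw : IsHighest w (n : K)) {p : ℕ} (hpn : p ≤ n) (hp : (fOp ^ p) w = 0) :
    w = 0 :=
  hw.pow_eq_zero p.zero_le (fun _ hk _ => Nat.cast_injective.ne (hk.trans_le hpn).ne') hp

lemma pow_succ_eq_zero (hw : IsHighest w (n : K)) (hp : ∃ p, (fOp ^ p) w = 0) :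
    (fOp ^ (n + 1)) w = 0 := by
  obtain ⟨p, hp⟩ := hp
  exact hw.pow_eq_zero (Nat.le_add_left (n + 1) p)
    (fun _ _ hk => Nat.cast_injective.ne (Nat.lt_of_succ_le hk).ne)
    (Module.End.pow_map_zero_of_le (p.le_add_right _) hp)

lemma eq_zero_of_jordanBlock {m : M} (hw : IsHighest w (n : K))
    (hf : IsLocallyNilpotent (fOp : M →ₗ[K] M)) (hem : eOp m = 0)
    (hhm : hOp m = (n : K) • m + w) : w = 0 := by
  have e_pow (k : ℕ) : eOp ((fOp ^ (k + 1)) m) =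
      (k + 1 : K) • ((n - k : K) • (fOp ^ k) m + (fOp ^ k) w) := by
    rw [e_f_pow, hem, hhm]
    simp only [map_sub, map_add, map_smul, map_zero]
    module
  have hfw : (fOp ^ (n + 1)) w = 0 := hw.pow_succ_eq_zero (hf w)
  have hfm : (fOp ^ (n + 1)) m = 0 := by
    obtain ⟨p, hp⟩ := hf m
    refine Nat.decreasingInduction' (P := fun k => (fOp ^ k) m = 0) (fun k _ hk hm => ?_)
      (Nat.le_add_left (n + 1) p) (Module.End.pow_map_zero_of_le (p.le_add_right _) hp)
    have hcoef := e_pow k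
    rw [hm, map_zero, Module.End.pow_map_zero_of_le hk hfw, add_zero, smul_smul] at hcoef
    exact (smul_eq_zero.mp hcoef.symm).resolve_left
      (mul_ne_zero (Nat.cast_add_one_ne_zero k)
        (sub_ne_zero.mpr (Nat.cast_injective.ne (Nat.lt_of_succ_le hk).ne)))
  have hcoef := e_pow n
  rw [hfm, map_zero, sub_self, zero_smul, zero_add] at hcoef
  exact hw.eq_zero_of_pow le_rfl
    ((smul_eq_zero.mp hcoef.symm).resolve_left (Nat.cast_add_one_ne_zero n))

end IsHighest

lemma IsStringVector.mem_map_e {n : ℕ} {y : M} (hy : IsStringVector y)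
    (hhy : hOp y = (n + 2 : K) • y) : y ∈ (Module.End.eigenspace hOp (n : K)).map eOp := by
  obtain ⟨w, N, j, hw, -, -, rfl⟩ := hy
  rcases eq_or_ne ((fOp ^ j) w) 0 with hzero | hne
  · rw [hzero]; exact zero_mem _
  have hN : (N : K) - 2 * j = n + 2 :=
    smul_left_injective K hne ((hw.h_pow j).symm.trans hhy)
  have hcoef : ((j + 1) * (N - j) : K) ≠ 0 := by
    have : ((j + 1) * (N - j) : K) = ((j + 1) * (n + 2 + j) : ℕ) := by
      push_cast
      linear_combination (j + 1 : K) * hN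
    rw [this]
    exact_mod_cast (by positivity)
  refine ⟨((j + 1) * (N - j) : K)⁻¹ • (fOp ^ (j + 1)) w, Submodule.smul_mem _ _ ?_, ?_⟩
  · rw [Module.End.mem_eigenspace_iff, hw.h_pow]
    congr 1
    push_cast
    linear_combination hN
  · rw [map_smul, hw.e_pow, inv_smul_smul₀ hcoef]

namespace IsStringSpanned

omit [CharZero K] in
lemma iSup_eigenspace_h (hM : IsStringSpanned M) :
    ⨆ ν, Module.End.eigenspace (hOp : M →ₗ[K] M) ν = ⊤ := by
  refine top_unique (hM.ge.trans (Submodule.span_le.mpr ?_))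
  rintro _ ⟨w, n, j, hw, -, -, rfl⟩
  exact Submodule.mem_iSup_of_mem _ (Module.End.mem_eigenspace_iff.mpr (hw.h_pow j))

lemma exists_e_eq (hM : IsStringSpanned M) {n : ℕ} {y : M} (hy : hOp y = (n + 2 : K) • y) :
    ∃ x, hOp x = (n : K) • x ∧ eOp x = y := by
  have hweight : ∀ x : {x : M // IsStringVector x}, ∃ ν : K, hOp x.1 = ν • x.1 := by
    rintro ⟨_, w, N, j, hw, -, -, rfl⟩
    exact ⟨_, hw.h_pow j⟩
  choose ev hev using hweight
  have hrange : y ∈ Submodule.span K (Set.range (Subtype.val : {x : M // IsStringVector x} → M)) :=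
    Subtype.range_coe.symm ▸ hM.symm ▸ Submodule.mem_top
  have hspan := mem_span_of_eigenvector (A := hOp) (b := Subtype.val) (ev := ev)
    (fun x => Module.End.mem_eigenspace_iff.mpr (hev x))
    hrange (Module.End.mem_eigenspace_iff.mpr hy)
  obtain ⟨x, hx, rfl⟩ := (Submodule.span_le (p := (Module.End.eigenspace hOp (n : K)).map eOp)).mpr
    (by rintro _ ⟨x, hx, rfl⟩; exact x.2.mem_map_e ((hev x).trans (by rw [hx]))) hspan
  exact ⟨x, Module.End.mem_eigenspace_iff.mp hx, rfl⟩

variable {V : Type*} [AddCommGroup V] [Module K V] [Sl2Module K V] {i : V →ₗ[K] M} {n : ℕ}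
  {m : M}

omit [CharZero K] in
lemma exists_add_h_sub (hV : IsStringSpanned V) (μ : K) (x : V) :
    ∃ w x₁, hOp w = μ • w ∧ w + (hOp x₁ - μ • x₁) = x := by
  obtain ⟨w, _, hw, ⟨x₁, rfl⟩, hx⟩ := Submodule.codisjoint_iff_exists_add_eq.mp
    (isCompl_eigenspace_range hV.iSup_eigenspace_h μ).codisjoint x
  exact ⟨w, x₁, Module.End.mem_eigenspace_iff.mp hw, hx⟩

omit [CharZero K] in
lemma eq_zero_of_h_sub_eq (hV : IsStringSpanned V) {μ : K} {x y : V} (hx : hOp x = μ • x)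
    (hy : hOp y - μ • y = x) : x = 0 :=
  Submodule.disjoint_def.mp (isCompl_eigenspace_range hV.iSup_eigenspace_h μ).disjoint x
    (Module.End.mem_eigenspace_iff.mpr hx) ⟨y, hy⟩

lemma exists_jordanBlock (hV : IsStringSpanned V) (hi : IsSl2Hom i) (hinj : Function.Injective i)
    (he : ∃ y, i y = eOp m) (hh : ∃ x, i x = hOp m - (n : K) • m) :
    ∃ x w, IsHighest w (n : K) ∧ eOp (m - i x) = 0 ∧
      hOp (m - i x) = (n : K) • (m - i x) + i w := by
  obtain ⟨y, hy⟩ := he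
  obtain ⟨x, hx⟩ := hh
  obtain ⟨w, x₁, hw, rfl⟩ := hV.exists_add_h_sub n x
  have h_m₁ : hOp (m - i x₁) = (n : K) • (m - i x₁) + i w := by
    rw [map_add, map_sub, map_smul, hi.map_h, ← eq_sub_iff_add_eq] at hx
    rw [hx, map_sub]
    module
  have h_y₁ : hOp (y - eOp x₁) - (n + 2 : K) • (y - eOp x₁) = eOp w := hinj <| by
    have e_m₁ : i (y - eOp x₁) = eOp (m - i x₁) := by rw [map_sub, map_sub, hy, hi.map_e]
    rw [map_sub, map_smul, hi.map_h, hi.map_e, e_m₁, h_e, h_m₁, map_add, map_smul]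
    module
  have h_ew : hOp (eOp w) = (n + 2 : K) • eOp w := by rw [h_e, hw, map_smul, add_smul]
  have ew : eOp w = 0 := hV.eq_zero_of_h_sub_eq h_ew h_y₁
  obtain ⟨x₂, h_x₂, e_x₂⟩ := hV.exists_e_eq (sub_eq_zero.mp (h_y₁.trans ew))
  refine ⟨x₁ + x₂, w, ⟨ew, hw⟩, ?_, ?_⟩
  · rw [map_add, ← sub_sub, map_sub, ← hi.map_e, e_x₂, map_sub i, map_sub, hy, hi.map_e, sub_self]
  · rw [map_add, ← sub_sub, map_sub, h_m₁, ← hi.map_h, h_x₂, map_smul]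
    module

theorem exists_highest_lift (hV : IsStringSpanned V) (hi : IsSl2Hom i)
    (hinj : Function.Injective i) (hf : IsLocallyNilpotent (fOp : M →ₗ[K] M))
    (he : ∃ y, i y = eOp m) (hh : ∃ x, i x = hOp m - (n : K) • m) :
    ∃ x, IsHighest (m - i x) (n : K) ∧ (fOp ^ (n + 1)) (m - i x) = 0 := by
  obtain ⟨x, w, hw, hem, hhm⟩ := hV.exists_jordanBlock hi hinj he hh
  have hiw : i w = 0 := (hw.map hi).eq_zero_of_jordanBlock hf hem hhm
  have hm : IsHighest (m - i x) (n : K) := ⟨hem, by rw [hhm, hiw, add_zero]⟩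
  exact ⟨x, hm, hm.pow_succ_eq_zero (hf _)⟩

end IsStringSpanned

end Field

section Schur

open Polynomial

universe u w

variable {K : Type u} {V : Type w} [Field K] [IsAlgClosed K] [AddCommGroup V] [Module K V]

omit [IsAlgClosed K] in
lemma eq_zero_of_sum_C_mul_prod_erase_eq_zero [DecidableEq K] {s : Finset K} {g : K → K}
    (hg : ∑ i ∈ s, C (g i) * ∏ j ∈ s.erase i, (X - C j) = 0) {r : K} (hr : r ∈ s) : g r = 0 := by
  have heval := congrArg (eval r) hg
  rw [eval_zero, eval_finsetSum, Finset.sum_eq_single_of_mem r hr fun i _ hir => by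
    rw [eval_mul, eval_prod, Finset.prod_eq_zero (Finset.mem_erase.mpr ⟨hir.symm, hr⟩) (by simp),
      mul_zero]] at heval
  simp only [eval_mul, eval_C, eval_prod, eval_sub, eval_X] at heval
  exact (mul_eq_zero.mp heval).resolve_right
    (Finset.prod_ne_zero_iff.mpr fun j hj => sub_ne_zero.mpr (Finset.ne_of_mem_erase hj).symm)

lemma isUnit_aeval_of_spectrum_eq_empty {R : Type*} [Ring R] [Algebra K R] {a : R}
    (ha : spectrum K a = ∅) {p : K[X]} (hp : p ≠ 0) : IsUnit (aeval a p) := by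
  rw [(IsAlgClosed.splits p).eq_prod_roots, map_mul, aeval_C]
  refine ((isUnit_iff_ne_zero.mpr (leadingCoeff_ne_zero.mpr hp)).map _).mul ?_
  by_contra h
  obtain ⟨r, hr, -⟩ := spectrum.exists_mem_of_not_isUnit_aeval_prod h
  rwa [ha] at hr

lemma linearIndependent_resolvent {A : Module.End K V} (hA : spectrum K A = ∅) {v : V}
    (hv : v ≠ 0) : LinearIndependent K fun r : K => resolvent A r v := by
  classical
  have apply_resolvent (r : K) : aeval A (X - C r) (resolvent A r v) = -v := by
    have hunit : IsUnit (algebraMap K (Module.End K V) r - A) := by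
      by_contra h
      exact (hA ▸ h : r ∈ (∅ : Set K))
    rw [map_sub, aeval_X, aeval_C, ← neg_sub, LinearMap.neg_apply, ← Module.End.mul_apply,
      resolvent, Ring.mul_inverse_cancel _ hunit, Module.End.one_apply]
  refine linearIndependent_iff'.mpr fun s g hg r hr => ?_
  refine eq_zero_of_sum_C_mul_prod_erase_eq_zero (not_imp_comm.mp
    (isUnit_aeval_of_spectrum_eq_empty hA) fun hunit => hv ?_) hr
  have hclear : aeval A (∑ i ∈ s, C (g i) * ∏ j ∈ s.erase i, (X - C j)) (-v) =
      aeval A (∏ j ∈ s, (X - C j)) (∑ i ∈ s, g i • resolvent A i v) := by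
    simp only [map_sum, LinearMap.sum_apply, map_smul]
    refine Finset.sum_congr rfl fun i hi => ?_
    rw [← Finset.prod_erase_mul s _ hi, map_mul (aeval A) (∏ _ ∈ _, _), Module.End.mul_apply,
      apply_resolvent, map_mul, Module.End.mul_apply, aeval_C, Module.algebraMap_end_apply]
  rw [hg, map_zero, map_neg, neg_eq_zero] at hclear
  exact (Module.End.isUnit_iff _).mp hunit |>.injective (hclear.trans (map_zero _).symm)

theorem exists_eq_smul_of_rank_lt {A : Type*} [Ring A] [Algebra K A] [Module A V]
    [IsScalarTower K A V] [IsSimpleModule A V]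
    (hrank : Cardinal.lift.{u} (Module.rank K V) < Cardinal.lift.{w} (Cardinal.mk K))
    (φ : V →ₗ[A] V) : ∃ r : K, ∀ x, φ x = r • x := by
  obtain ⟨r, hr⟩ : (spectrum K (φ.restrictScalars K)).Nonempty := by
    by_contra! hempty
    have := IsSimpleModule.nontrivial A V
    obtain ⟨v, hv⟩ := exists_ne (0 : V)
    exact hrank.not_ge (linearIndependent_resolvent hempty hv).cardinal_lift_le_rank
  have hcomm : SMulCommClass A K V := IsScalarTower.to_smulCommClass'
  let ψ : V →ₗ[A] V := r • LinearMap.id - φ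
  have hψ : ψ = 0 := by
    by_contra h
    exact hr ((Module.End.isUnit_iff _).mpr (LinearMap.bijective_of_ne_zero (f := ψ) h))
  exact ⟨r, fun x => (sub_eq_zero.mp (LinearMap.congr_fun hψ x)).symm⟩

end Schur

section Ext

open CategoryTheory Abelian

section Connecting

variable {C : Type*} [Category* C] [Abelian C] [HasExt C] {S : ShortComplex C}
  (k : Type*) [CommRing k] [Linear k C] (hS : S.ShortExact) (Y : C)

/-- The connecting homomorphism `Hom(X₁, Y) → Ext¹(X₃, Y)` of a short exact sequence. -/
def extConnecting : (S.X₁ ⟶ Y) →ₗ[k] Ext S.X₃ Y 1 :=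
  (Ext.bilinearCompOfLinear k S.X₃ S.X₁ Y 1 0 1 rfl hS.extClass) ∘ₗ
    (Ext.linearEquiv₀ (R := k)).symm.toLinearMap

lemma extConnecting_apply (φ : S.X₁ ⟶ Y) :
    extConnecting k hS Y φ = hS.extClass.comp (Ext.mk₀ φ) rfl := rfl

variable {Y}

lemma extConnecting_surjective [Projective S.X₂] :
    Function.Surjective (extConnecting k hS Y) := fun x => by
  obtain ⟨y, hy⟩ := Ext.contravariant_sequence_exact₃ hS Y x (Ext.eq_zero_of_projective _)
    (n₀ := 0) rfl
  obtain ⟨φ, rfl⟩ := (Ext.mk₀_bijective S.X₁ Y).surjective y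
  exact ⟨φ, hy⟩

lemma extConnecting_eq_zero_iff {φ : S.X₁ ⟶ Y} :
    extConnecting k hS Y φ = 0 ↔ ∃ ψ : S.X₂ ⟶ Y, S.f ≫ ψ = φ := by
  refine ⟨fun h0 => ?_, ?_⟩
  · obtain ⟨y, hy⟩ := Ext.contravariant_sequence_exact₁ hS Y (Ext.mk₀ φ) rfl h0
    obtain ⟨ψ, rfl⟩ := (Ext.mk₀_bijective S.X₂ Y).surjective y
    rw [Ext.mk₀_comp_mk₀] at hy
    exact ⟨ψ, (Ext.mk₀_bijective S.X₁ Y).injective hy⟩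
  · rintro ⟨ψ, rfl⟩
    rw [extConnecting_apply, ← Ext.mk₀_comp_mk₀, ← Ext.comp_assoc_of_third_deg_zero,
      hS.extClass_comp, Ext.zero_comp]

end Connecting

section Cyclic

open Ideal (torsionOf)

universe u

variable {A : Type} [Ring A] {V W : ModuleCat.{u} A} (v : V)

/-- The complex `Ann(v) → A → V`. -/
def torsionOfComplex : ShortComplex (ModuleCat.{u} A) where
  X₁ := ModuleCat.of A (ULift.{u} (torsionOf A V v))
  X₂ := ModuleCat.of A (ULift.{u} A)
  X₃ := V
  f := ModuleCat.ofHom (ULift.moduleEquiv.symm.toLinearMap ∘ₗ (torsionOf A V v).subtype ∘ₗ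
    ULift.moduleEquiv.toLinearMap)
  g := ModuleCat.ofHom (LinearMap.toSpanSingleton A V v ∘ₗ ULift.moduleEquiv.toLinearMap)
  zero := by
    ext ⟨_, hx⟩
    exact hx

instance : Projective (torsionOfComplex v).X₂ := by
  have : Module.Projective A (ULift.{u} A) := Module.Projective.of_equiv ULift.moduleEquiv.symm
  exact (IsProjective.iff_projective (ULift.{u} A)).mp this

variable {v}

lemma torsionOfComplex_shortExact (hv : ∀ x : V, ∃ a : A, a • v = x) :
    (torsionOfComplex v).ShortExact where
  exact := by
    rw [ShortComplex.moduleCat_exact_iff]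
    rintro ⟨a⟩ ha
    exact ⟨⟨⟨a, ha⟩⟩, rfl⟩
  mono_f := (ModuleCat.mono_iff_injective _).mpr fun x y hxy =>
    ULift.ext _ _ (Subtype.ext (congrArg ULift.down hxy))
  epi_g := (ModuleCat.epi_iff_surjective _).mpr fun x => by
    obtain ⟨a, ha⟩ := hv x
    exact ⟨⟨a⟩, ha⟩

lemma exists_torsionOfComplex_f_comp_eq_iff {φ : (torsionOfComplex v).X₁ ⟶ W} :
    (∃ ψ, (torsionOfComplex v).f ≫ ψ = φ) ↔
      ∃ m : W, ∀ a : torsionOf A V v, φ.hom ⟨a⟩ = (a : A) • m := by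
  refine ⟨?_, fun ⟨m, hm⟩ => ?_⟩
  · rintro ⟨ψ, rfl⟩
    refine ⟨ψ.hom ⟨1⟩, fun a => ?_⟩
    exact (congrArg ψ.hom (ULift.ext _ _ (mul_one (a : A)).symm)).trans
      (ψ.hom.map_smul (a : A) (ULift.up (1 : A)))
  · refine ⟨ModuleCat.ofHom (LinearMap.toSpanSingleton A W m ∘ₗ ULift.moduleEquiv.toLinearMap), ?_⟩
    ext ⟨a⟩
    exact (hm a).symm

open ModuleCat in
theorem ext_self_equiv {k : Type*} [Field k] [Algebra k A] (hv : ∀ x : V, ∃ a : A, a • v = x)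
    (z : torsionOf A V v) (hz : ∀ x : V, (z : A) • x = 0)
    (h_scalar : ∀ φ : torsionOf A V v →ₗ[A] V, ∃ r : k, φ z = algebraMap k A r • v)
    (h_ne : ∃ φ : torsionOf A V v →ₗ[A] V, φ z ≠ 0)
    (h_extend : ∀ φ : torsionOf A V v →ₗ[A] V, φ z = 0 →
      ∃ m : V, ∀ a : torsionOf A V v, φ a = (a : A) • m) :
    Nonempty (Ext V V 1 ≃ₗ[k] k) := by
  let S := torsionOfComplex v
  have hS : S.ShortExact := torsionOfComplex_shortExact hv
  let ev : (S.X₁ ⟶ V) →ₗ[k] V :=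
    { toFun := fun φ => φ.hom ⟨z⟩, map_add' := fun _ _ => rfl, map_smul' := fun _ _ => rfl }
  have hker : LinearMap.ker (extConnecting k hS V) = LinearMap.ker ev := by
    ext φ
    rw [LinearMap.mem_ker, LinearMap.mem_ker, extConnecting_eq_zero_iff,
      exists_torsionOfComplex_f_comp_eq_iff]
    exact ⟨fun ⟨m, hm⟩ => (hm z).trans (hz m),
      h_extend (φ.hom ∘ₗ ULift.moduleEquiv.symm.toLinearMap)⟩
  obtain ⟨φ, hφ⟩ := h_ne
  let φ₀ : S.X₁ ⟶ V := ModuleCat.ofHom (φ ∘ₗ ULift.moduleEquiv.toLinearMap)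
  obtain ⟨r, hr⟩ : ∃ r : k, φ z = r • v := h_scalar φ
  obtain ⟨hr0, hv0⟩ : r ≠ 0 ∧ v ≠ 0 := smul_ne_zero_iff.mp (hr ▸ hφ)
  have hrange : LinearMap.range ev = k ∙ v := by
    refine le_antisymm ?_ ((Submodule.span_singleton_le_iff_mem _ _).mpr
      ⟨r⁻¹ • φ₀, ?_⟩)
    · rintro _ ⟨ψ, rfl⟩
      obtain ⟨s, hs⟩ := h_scalar (ψ.hom ∘ₗ ULift.moduleEquiv.symm.toLinearMap)
      exact Submodule.mem_span_singleton.mpr ⟨s, hs.symm⟩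
    · rw [map_smul]
      exact (inv_smul_eq_iff₀ hr0).mpr hr
  exact ⟨((extConnecting k hS V).quotKerEquivOfSurjective (extConnecting_surjective k hS)).symm ≪≫ₗ
    Submodule.quotEquivOfEq _ _ hker ≪≫ₗ ev.quotKerEquivRange ≪≫ₗ LinearEquiv.ofEq _ _ hrange ≪≫ₗ
    (LinearEquiv.toSpanNonzeroSingleton k V v hv0).symm⟩

end Cyclic

end Ext

section Pushout

open Ideal (torsionOf)

variable {A V W : Type*} [Ring A] [AddCommGroup V] [Module A V] [AddCommGroup W] [Module A W]
  {v : V} (φ : torsionOf A V v →ₗ[A] W)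

/-- The pushout of `Ann(v) → A` along `φ : Ann(v) → W`, which is an extension of `A v` by `W`. -/
abbrev Pushout : Type _ := (W × A) ⧸ LinearMap.range ((-φ).prod (torsionOf A V v).subtype)

/-- The inclusion of `W` into the pushout. -/
def pushoutInl : W →ₗ[A] Pushout φ := Submodule.mkQ _ ∘ₗ LinearMap.inl A W A

/-- The projection of the pushout to `A v ⊆ V`. -/
def pushoutProj : Pushout φ →ₗ[A] V :=
  Submodule.liftQ _ (LinearMap.toSpanSingleton A V v ∘ₗ LinearMap.snd A W A) (by
    rintro _ ⟨k, rfl⟩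
    exact k.2)

/-- The image of `1 ∈ A` in the pushout, a lift of the generator `v`. -/
def pushoutOne : Pushout φ := Submodule.Quotient.mk (0, 1)

lemma pushoutProj_one : pushoutProj φ (pushoutOne φ) = v := one_smul A v

lemma pushoutInl_injective : Function.Injective (pushoutInl φ) := by
  refine (injective_iff_map_eq_zero _).mpr fun x hx => ?_
  obtain ⟨k, hk⟩ := (Submodule.Quotient.mk_eq_zero _).mp hx
  have hk0 : k = 0 := Subtype.ext (congrArg Prod.snd hk)
  have hφ : -φ k = x := congrArg Prod.fst hk
  rw [← hφ, hk0, map_zero, neg_zero]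

lemma smul_pushoutOne (a : A) : a • pushoutOne φ = Submodule.Quotient.mk (0, a) :=
  congrArg Submodule.Quotient.mk (Prod.ext (smul_zero a) (mul_one a))

lemma smul_pushoutOne_of_mem_torsionOf (k : torsionOf A V v) :
    (k : A) • pushoutOne φ = pushoutInl φ (φ k) := by
  rw [smul_pushoutOne]
  exact (Submodule.Quotient.eq _).mpr
    ⟨k, Prod.ext (zero_sub _).symm (sub_zero _).symm⟩

lemma pushout_exact : Function.Exact (pushoutInl φ) (pushoutProj φ) := by
  intro x
  refine ⟨fun hx => ?_, ?_⟩
  · obtain ⟨⟨y, a⟩, rfl⟩ := Submodule.Quotient.mk_surjective _ x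
    refine ⟨y + φ ⟨a, hx⟩, ?_⟩
    rw [map_add, ← smul_pushoutOne_of_mem_torsionOf, smul_pushoutOne]
    exact congrArg Submodule.Quotient.mk (Prod.ext (add_zero y) (zero_add a))
  · rintro ⟨y, rfl⟩
    exact zero_smul A v

end Pushout

section Takiff

lemma U_induction {P : U → Prop} (algebraMap : ∀ r : ℂ, P (algebraMap ℂ U r))
    (iota : ∀ t, P (UniversalEnvelopingAlgebra.ι ℂ t)) (mul : ∀ a b, P a → P b → P (a * b))
    (add : ∀ a b, P a → P b → P (a + b)) (u : U) : P u := by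
  obtain ⟨u, rfl⟩ : ∃ x, UniversalEnvelopingAlgebra.mkAlgHom ℂ Takiff x = u :=
    (UniversalEnvelopingAlgebra.ringCon ℂ Takiff).mk'_surjective u
  induction u using TensorAlgebra.induction with
  | algebraMap r => rw [AlgHom.commutes]; exact algebraMap r
  | ι t => exact iota t
  | mul a b ha hb => rw [map_mul]; exact mul _ _ ha hb
  | add a b ha hb => rw [map_add]; exact add _ _ ha hb

lemma even_incl (a : Sl2) : even (incl a) = a :=
  (even_tens 1 a).trans (one_smul ℂ a)

lemma odd_incl (a : Sl2) : odd (incl a) = 0 :=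
  (odd_tens 1 a).trans (zero_smul ℂ a)

lemma even_bar (a : Sl2) : even (bar a) = 0 :=
  (even_tens DualNumber.eps a).trans (zero_smul ℂ a)

lemma odd_bar (a : Sl2) : odd (bar a) = a :=
  (odd_tens DualNumber.eps a).trans (one_smul ℂ a)

lemma incl_even_add_bar_odd (t : Takiff) : incl (even t) + bar (odd t) = t := by
  induction t using takiff_induction with
  | zero => simp only [map_zero, add_zero]
  | add x y hx hy =>
    rw [map_add, map_add, map_add, map_add, add_add_add_comm, hx, hy]
  | tmul a v =>
    have ha : a.fst • 1 + a.snd • DualNumber.eps = a := by ext <;> simp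
    rw [even_tens, odd_tens, map_smul, map_smul]
    conv_rhs => rw [← ha]
    exact ((TensorProduct.add_tmul _ _ _).trans (congrArg₂ (· + ·)
      (TensorProduct.smul_tmul' _ _ _).symm (TensorProduct.smul_tmul' _ _ _).symm)).symm

end Takiff

section Operators

variable {M : Type*} [AddCommGroup M] [Module ℂ M] [Module U M] [IsScalarTower ℂ U M]

/-- The action of an element of `U(𝔗)` on a module, as a `ℂ`-linear map. -/
def act (u : U) : M →ₗ[ℂ] M := Algebra.lsmul ℂ ℂ M u

/-- The operator of `ē`. -/
def eBar : M →ₗ[ℂ] M := act (uBar e)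

/-- The operator of `f̄`. -/
def fBar : M →ₗ[ℂ] M := act (uBar f)

/-- The operator of `h̄`. -/
def hBar : M →ₗ[ℂ] M := act (uBar h)

lemma uIncl_smul_uIncl_smul {a b c : Sl2} {r : ℂ} (hab : ⁅a, b⁆ = r • c) (m : M) :
    uIncl a • uIncl b • m = uIncl b • uIncl a • m + r • uIncl c • m := by
  rw [← smul_assoc r, ← uIncl_smul, ← hab, uIncl_lie, sub_smul, mul_smul, mul_smul,
    add_sub_cancel]

lemma uIncl_smul_uBar_smul {a b c : Sl2} {r : ℂ} (hab : ⁅a, b⁆ = r • c) (m : M) :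
    uIncl a • uBar b • m = uBar b • uIncl a • m + r • uBar c • m := by
  rw [← smul_assoc r, ← uBar_smul, ← hab, uBar_lie, sub_smul, mul_smul, mul_smul, add_sub_cancel]

lemma uIncl_smul_uBar_smul_self (a : Sl2) (m : M) :
    uIncl a • uBar a • m = uBar a • uIncl a • m := by
  rw [uIncl_smul_uBar_smul (r := 0) (c := 0) (by rw [lie_self, smul_zero]) m, zero_smul, add_zero]

omit [Module ℂ M] [IsScalarTower ℂ U M] in
lemma uBar_smul_uBar_smul (a b : Sl2) (m : M) : uBar a • uBar b • m = uBar b • uBar a • m := by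
  rw [← mul_smul, uBar_comm, mul_smul]

lemma lie_f_e : ⁅f, e⁆ = (-1 : ℂ) • h := by rw [← lie_skew, lie_e_f, neg_one_smul]

lemma lie_e_h : ⁅e, h⁆ = (-2 : ℂ) • e := by rw [← lie_skew, lie_h_e, neg_smul]

lemma lie_f_h : ⁅f, h⁆ = (2 : ℂ) • f := by rw [← lie_skew, lie_h_f, neg_smul, neg_neg]

instance : Sl2Module ℂ M where
  eOp := act (uIncl e)
  fOp := act (uIncl f)
  hOp := act (uIncl h)
  e_f m := (uIncl_smul_uIncl_smul (lie_e_f.trans (one_smul ℂ h).symm) m).trans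
    (by rw [one_smul]; rfl)
  h_e := uIncl_smul_uIncl_smul lie_h_e
  h_f m := (uIncl_smul_uIncl_smul lie_h_f m).trans (by rw [neg_smul, ← sub_eq_add_neg]; rfl)

lemma eOp_apply (m : M) : eOp m = uIncl e • m := rfl

lemma fOp_apply (m : M) : fOp m = uIncl f • m := rfl

lemma hOp_apply (m : M) : hOp m = uIncl h • m := rfl

lemma eBar_apply (m : M) : eBar m = uBar e • m := rfl

lemma fBar_apply (m : M) : fBar m = uBar f • m := rfl

lemma hBar_apply (m : M) : hBar m = uBar h • m := rfl

lemma e_fBar (m : M) : eOp (fBar m) = fBar (eOp m) + hBar m :=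
  (uIncl_smul_uBar_smul (lie_e_f.trans (one_smul ℂ h).symm) m).trans (by rw [one_smul]; rfl)

lemma e_hBar (m : M) : eOp (hBar m) = hBar (eOp m) - (2 : ℂ) • eBar m :=
  (uIncl_smul_uBar_smul lie_e_h m).trans (by rw [neg_smul, ← sub_eq_add_neg]; rfl)

lemma e_eBar (m : M) : eOp (eBar m) = eBar (eOp m) := uIncl_smul_uBar_smul_self e m

lemma h_fBar (m : M) : hOp (fBar m) = fBar (hOp m) - (2 : ℂ) • fBar m :=
  (uIncl_smul_uBar_smul lie_h_f m).trans (by rw [neg_smul, ← sub_eq_add_neg]; rfl)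

lemma h_hBar (m : M) : hOp (hBar m) = hBar (hOp m) := uIncl_smul_uBar_smul_self h m

lemma h_eBar (m : M) : hOp (eBar m) = eBar (hOp m) + (2 : ℂ) • eBar m :=
  uIncl_smul_uBar_smul lie_h_e m

lemma fBar_f (m : M) : fBar (fOp m) = fOp (fBar m) := (uIncl_smul_uBar_smul_self f m).symm

lemma hBar_f (m : M) : hBar (fOp m) = fOp (hBar m) - (2 : ℂ) • fBar m :=
  eq_sub_of_add_eq (uIncl_smul_uBar_smul lie_f_h m).symm

lemma eBar_f (m : M) : eBar (fOp m) = fOp (eBar m) + hBar m := by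
  have hcomm := uIncl_smul_uBar_smul lie_f_e m
  rw [neg_one_smul, ← sub_eq_add_neg] at hcomm
  exact (add_eq_of_eq_sub hcomm).symm

lemma hBar_fBar (m : M) : hBar (fBar m) = fBar (hBar m) := uBar_smul_uBar_smul _ _ _

lemma eBar_fBar (m : M) : eBar (fBar m) = fBar (eBar m) := uBar_smul_uBar_smul _ _ _

lemma eBar_hBar (m : M) : eBar (hBar m) = hBar (eBar m) := uBar_smul_uBar_smul _ _ _

/-- The operator of the central element `C̄`. -/
def cBar : M →ₗ[ℂ] M := act Cbar

lemma cBar_apply (m : M) : cBar m = Cbar • m := rfl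

lemma cBar_eq (m : M) : cBar m = hBar (hBar m) + (4 : ℂ) • fBar (eBar m) := by
  have h4 : (4 : U) = algebraMap ℂ U 4 := (map_ofNat (algebraMap ℂ U) 4).symm
  simp only [cBar_apply, Cbar, hBar_apply, fBar_apply, eBar_apply, add_smul, pow_two, mul_smul, h4,
    algebraMap_smul]

/-- The operator of the central element `h h̄ + 2 h̄ + 2 f ē + 2 f̄ e`, the polarization of the
Casimir element of `𝔰𝔩₂`. -/
def cMix : M →ₗ[ℂ] M :=
  hBar ∘ₗ hOp + (2 : ℂ) • hBar + (2 : ℂ) • fOp ∘ₗ eBar + (2 : ℂ) • fBar ∘ₗ eOp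

lemma cMix_apply (m : M) : cMix m = hBar (hOp m) + (2 : ℂ) • hBar m + (2 : ℂ) • fOp (eBar m) +
    (2 : ℂ) • fBar (eOp m) := rfl

lemma cMix_f (m : M) : cMix (fOp m) = fOp (cMix m) := by
  simp only [cMix_apply, e_f, h_f, eBar_f, hBar_f, fBar_f, map_add, map_sub, map_smul]
  module

lemma cMix_e (m : M) : cMix (eOp m) = eOp (cMix m) := by
  simp only [cMix_apply, e_f, h_e, e_fBar, e_hBar, e_eBar, h_eBar, map_add, map_smul]
  module

lemma cMix_h (m : M) : cMix (hOp m) = hOp (cMix m) := by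
  simp only [eq_sub_of_add_eq' (e_f _).symm, map_sub, cMix_e, cMix_f]

lemma cMix_eBar (m : M) : cMix (eBar m) = eBar (cMix m) := by
  simp only [cMix_apply, h_eBar, e_eBar, eBar_hBar, eBar_f, eBar_fBar, map_add, map_smul]
  module

lemma cBar_f (m : M) : cBar (fOp m) = fOp (cBar m) := by
  simp only [cBar_eq, eBar_f, hBar_f, fBar_f, hBar_fBar, map_add, map_sub, map_smul]
  module

lemma cBar_e (m : M) : cBar (eOp m) = eOp (cBar m) := by
  simp only [cBar_eq, e_fBar, e_hBar, e_eBar, eBar_hBar, map_add, map_sub, map_smul]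
  module

lemma cBar_eBar (m : M) : cBar (eBar m) = eBar (cBar m) := by
  simp only [cBar_eq, eBar_fBar, eBar_hBar, map_add, map_smul]

section Stable

variable {S : Submodule ℂ M}

lemma smul_mem_of_uIncl_of_uBar (h_incl : ∀ a : Sl2, ∀ m ∈ S, uIncl a • m ∈ S)
    (h_bar : ∀ a : Sl2, ∀ m ∈ S, uBar a • m ∈ S) (u : U) {m : M} (hm : m ∈ S) : u • m ∈ S := by
  induction u using U_induction generalizing m with
  | algebraMap r => rw [algebraMap_smul]; exact S.smul_mem _ hm
  | iota t =>
    rw [← incl_even_add_bar_odd t, map_add, add_smul]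
    exact add_mem (h_incl _ m hm) (h_bar _ m hm)
  | mul a b ha hb => rw [mul_smul]; exact ha (hb hm)
  | add a b ha hb => rw [add_smul]; exact add_mem (ha hm) (hb hm)

lemma smul_mem_of_generators (he : ∀ m ∈ S, eOp m ∈ S) (hf : ∀ m ∈ S, fOp m ∈ S)
    (hb : ∀ m ∈ S, eBar m ∈ S) (u : U) {m : M} (hm : m ∈ S) : u • m ∈ S := by
  have h_mem : ∀ m ∈ S, hOp m ∈ S := fun m hm => by
    rw [eq_sub_of_add_eq' (e_f m).symm]; exact sub_mem (he _ (hf _ hm)) (hf _ (he _ hm))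
  have hBar_mem : ∀ m ∈ S, hBar m ∈ S := fun m hm => by
    rw [eq_sub_of_add_eq' (eBar_f m).symm]; exact sub_mem (hb _ (hf _ hm)) (hf _ (hb _ hm))
  have fBar_mem : ∀ m ∈ S, fBar m ∈ S := fun m hm => by
    have hcomm : fBar m = (2⁻¹ : ℂ) • (fOp (hBar m) - hBar (fOp m)) := by rw [hBar_f]; module
    rw [hcomm]
    exact S.smul_mem _ (sub_mem (hf _ (hBar_mem _ hm)) (hBar_mem _ (hf _ hm)))
  refine smul_mem_of_uIncl_of_uBar (fun a m hm => ?_) (fun a m hm => ?_) u hm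
  all_goals obtain ⟨x, y, z, rfl⟩ := sl2_decomp a
  · simp only [uIncl_add, uIncl_smul, add_smul, smul_assoc]
    exact add_mem (add_mem (S.smul_mem _ (hf m hm)) (S.smul_mem _ (h_mem m hm)))
      (S.smul_mem _ (he m hm))
  · simp only [uBar_add, uBar_smul, add_smul, smul_assoc]
    exact add_mem (add_mem (S.smul_mem _ (fBar_mem m hm)) (S.smul_mem _ (hBar_mem m hm)))
      (S.smul_mem _ (hb m hm))

omit [IsScalarTower ℂ U M] in
lemma eq_top_of_isSimpleModule [IsSimpleModule U M] (hS : ∀ (u : U), ∀ x ∈ S, u • x ∈ S) {w : M}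
    (hw : w ∈ S) (hw0 : w ≠ 0) : S = ⊤ := by
  let S' : Submodule U M := { S with smul_mem' := fun u _ hx => hS u _ hx }
  have htop : S' = ⊤ :=
    (eq_bot_or_eq_top S').resolve_left fun hbot => hw0 ((Submodule.mem_bot U).mp (hbot ▸ hw))
  exact top_unique fun x _ => htop.ge (Submodule.mem_top : x ∈ ⊤)

end Stable

section Schur

variable [IsSimpleModule U M]

lemma rank_le_aleph0 : Module.rank ℂ M ≤ Cardinal.aleph0 := by
  have := IsSimpleModule.nontrivial U M
  obtain ⟨v, hv⟩ := exists_ne (0 : M)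
  let op : Fin 3 → M →ₗ[ℂ] M := ![eOp, fOp, eBar]
  let word : List (Fin 3) → M := fun l => l.foldr (fun i x => op i x) v
  let S := Submodule.span ℂ (Set.range word)
  have hstab (i : Fin 3) : ∀ x ∈ S, op i x ∈ S := fun x hx => by
    refine (Submodule.span_le (p := S.comap (op i))).mpr ?_ hx
    rintro _ ⟨l, rfl⟩
    exact Submodule.subset_span ⟨i :: l, rfl⟩
  have hS : S = ⊤ := eq_top_of_isSimpleModule
    (fun u x hx => smul_mem_of_generators (hstab 0) (hstab 1) (hstab 2) u hx)
    (Submodule.subset_span ⟨[], rfl⟩ : v ∈ S) hv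
  rw [← rank_top ℂ M, ← hS]
  exact (rank_span_le _).trans (Set.countable_range word).le_aleph0

theorem exists_eq_smul (φ : M →ₗ[U] M) : ∃ r : ℂ, ∀ x, φ x = r • x := by
  refine exists_eq_smul_of_rank_lt ?_ φ
  rw [Cardinal.mk_complex, Cardinal.lift_continuum]
  exact (Cardinal.lift_le_aleph0.mpr rank_le_aleph0).trans_lt Cardinal.aleph0_lt_continuum

end Schur

section Maps

variable {N : Type*} [AddCommGroup N] [Module ℂ N] [Module U N] [IsScalarTower ℂ U N]
  (φ : M →ₗ[U] N)

lemma isSl2Hom_restrictScalars : IsSl2Hom (φ.restrictScalars ℂ) :=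
  ⟨φ.map_smul _, φ.map_smul _, φ.map_smul _⟩

lemma map_eOp (x : M) : φ (eOp x) = eOp (φ x) := φ.map_smul _ _

lemma map_hOp (x : M) : φ (hOp x) = hOp (φ x) := φ.map_smul _ _

lemma map_fOp (x : M) : φ (fOp x) = fOp (φ x) := φ.map_smul _ _

lemma map_eBar (x : M) : φ (eBar x) = eBar (φ x) := φ.map_smul _ _

lemma map_fBar (x : M) : φ (fBar x) = fBar (φ x) := φ.map_smul _ _

lemma map_hBar (x : M) : φ (hBar x) = hBar (φ x) := φ.map_smul _ _

lemma map_cMix (x : M) : φ (cMix x) = cMix (φ x) := by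
  simp only [cMix_apply, map_add, φ.map_smul_of_tower, map_eOp, map_fOp, map_hOp, map_eBar,
    map_fBar, map_hBar]

lemma map_f_pow (k : ℕ) (x : M) : φ ((fOp ^ k) x) = (fOp ^ k) (φ x) :=
  map_pow_apply_of_map_apply (φ := φ.restrictScalars ℂ) (map_fOp φ) k x

lemma map_eBar_pow (k : ℕ) (x : M) : φ ((eBar ^ k) x) = (eBar ^ k) (φ x) :=
  map_pow_apply_of_map_apply (φ := φ.restrictScalars ℂ) (map_eBar φ) k x

end Maps

end Operators

section HighestWeightVectors

variable {M : Type*} [AddCommGroup M] [Module ℂ M] [Module U M] [IsScalarTower ℂ U M]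

namespace IsHighest

variable {w : M} {μ : ℂ}

protected lemma eBar (hw : IsHighest w μ) : IsHighest (eBar w) (μ + 2) :=
  ⟨by rw [e_eBar, hw.e, map_zero], by rw [h_eBar, hw.h, map_smul, add_smul]⟩

protected lemma cMix (hw : IsHighest w μ) : IsHighest (cMix w) μ :=
  ⟨by rw [← cMix_e, hw.e, map_zero], by rw [← cMix_h, hw.h, map_smul]⟩

lemma eBar_pow {n : ℕ} (hw : IsHighest w (n : ℂ)) (k : ℕ) :
    IsHighest ((eBar ^ k) w) ((n + 2 * k : ℕ) : ℂ) := by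
  induction k with
  | zero => simpa using hw
  | succ k ih =>
    rw [pow_succ', Module.End.mul_apply]
    convert ih.eBar using 1
    push_cast
    ring

lemma add_two_smul_hBar (hw : IsHighest w μ) :
    (μ + 2) • hBar w = cMix w - (2 : ℂ) • fOp (eBar w) := by
  rw [cMix_apply, hw.e, hw.h, map_zero, map_smul]
  module

lemma smul_fBar_eBar (hw : IsHighest w μ) : (4 * μ + 12) • fBar (eBar w) =
    (μ + 2) • cBar w - hBar (cMix w) + (2 : ℂ) • fOp (hBar (eBar w)) := by
  have h_hBar := congrArg hBar hw.add_two_smul_hBar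
  simp only [map_sub, map_smul, hBar_f] at h_hBar
  linear_combination (norm := module) -h_hBar - (μ + 2) • cBar_eq w

end IsHighest

/-- The operator taking highest weight vectors of weight `μ` to highest weight vectors of weight
`μ - 2`: up to a scalar, the component of weight `μ - 2` of the map `𝔤̄ ⊗ M → M`. -/
def lower (μ : ℂ) (m : M) : M :=
  (μ * (μ + 1)) • fBar m - (μ + 1) • fOp (hBar m) - fOp (fOp (eBar m))

protected lemma IsHighest.lower {m : M} {μ : ℂ} (hm : IsHighest m μ) :
    IsHighest (lower μ m) (μ - 2) := by
  constructor
  · simp only [lower, map_sub, map_smul, e_fBar, e_f, e_hBar, e_eBar, h_hBar, h_f, h_eBar, hm.e,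
      hm.h, map_zero, map_add]
    module
  · simp only [lower, map_sub, map_smul, h_fBar, h_hBar, h_f, h_eBar, hm.h, map_add]
    module

lemma map_lower {N : Type*} [AddCommGroup N] [Module ℂ N] [Module U N] [IsScalarTower ℂ U N]
    (φ : M →ₗ[U] N) (μ : ℂ) (x : M) : φ (lower μ x) = lower μ (φ x) := by
  simp only [lower, map_sub, φ.map_smul_of_tower, map_fOp, map_eBar, map_fBar, map_hBar]

lemma IsHighest.cMix_cMix {m : M} {μ : ℂ} (hm : IsHighest m μ) (hμ : μ + 2 ≠ 0)
    (hl : lower μ m = 0) : TakiffSl2.cMix (TakiffSl2.cMix m) = μ ^ 2 • cBar m := by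
  have f_hBar_eBar := congrArg fOp hm.eBar.add_two_smul_hBar
  have hBar_cMix := hm.cMix.add_two_smul_hBar
  have eBar_lower := congrArg TakiffSl2.eBar hl
  rw [cMix_eBar] at f_hBar_eBar
  simp only [lower, map_sub, map_smul, map_add, map_zero, eBar_fBar, eBar_f, eBar_hBar,
    hBar_f] at f_hBar_eBar eBar_lower
  refine sub_eq_zero.mp ((smul_eq_zero.mp ?_).resolve_left hμ)
  linear_combination (norm := module) (4 * (μ + 1) * (μ + 2)) • cBar_eq m
    - (4 * (μ + 2)) • eBar_lower - (2 * (μ + 2)) • f_hBar_eBar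
    + ((μ + 2) * (μ + 2)) • hm.smul_fBar_eBar - (μ + 2) • hBar_cMix

section Invariants

variable {m : M}

lemma hBar_eq_neg_of_f_eq_zero (hf : fOp m = 0) : hBar m = -fOp (eBar m) := by
  have hcomm := eBar_f m
  rw [hf, map_zero] at hcomm
  exact (neg_eq_of_add_eq_zero_right hcomm.symm).symm

lemma two_smul_fBar_of_f_eq_zero (hf : fOp m = 0) : (2 : ℂ) • fBar m = fOp (hBar m) := by
  have hcomm := hBar_f m
  rw [hf, map_zero] at hcomm
  exact (sub_eq_zero.mp hcomm.symm).symm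

lemma IsHighest.cMix_eq_zero (hm : IsHighest m 0) (hf : fOp m = 0) : TakiffSl2.cMix m = 0 := by
  rw [cMix_apply, hm.e, hm.h, hBar_eq_neg_of_f_eq_zero hf]
  simp

end Invariants

section LocallyNilpotent

lemma f_pow_eBar (x : M) (k : ℕ) : (fOp ^ (k + 2)) (eBar x) = eBar ((fOp ^ (k + 2)) x) -
    (k + 2 : ℂ) • hBar ((fOp ^ (k + 1)) x) - ((k + 1) * (k + 2) : ℂ) • fBar ((fOp ^ k) x) := by
  induction k with
  | zero =>
    simp only [pow_succ, pow_zero, one_mul, Module.End.mul_apply, Module.End.one_apply, zero_add,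
      eBar_f, hBar_f, map_add]
    push_cast
    module
  | succ k ih =>
    rw [show k + 1 + 2 = (k + 2) + 1 by ring, pow_succ', Module.End.mul_apply, ih]
    simp only [pow_succ', Module.End.mul_apply, map_sub, map_smul, eBar_f, hBar_f, fBar_f]
    push_cast
    module

lemma exists_f_pow_eBar_pow_eq_zero {x : M} (hx : ∃ p, (fOp ^ p) x = 0) (k : ℕ) :
    ∃ p, (fOp ^ p) ((eBar ^ k) x) = 0 := by
  induction k with
  | zero => exact hx
  | succ k ih =>
    obtain ⟨p, hp⟩ := ih
    have hp' (i : ℕ) : (fOp ^ (p + i)) ((eBar ^ k) x) = 0 :=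
      Module.End.pow_map_zero_of_le (p.le_add_right i) hp
    refine ⟨p + 2, ?_⟩
    rw [pow_succ' eBar, Module.End.mul_apply, f_pow_eBar, hp, hp', hp']
    simp

lemma IsHighest.f_pow_eBar_pow_eq_zero {w : M} {n : ℕ} (hw : IsHighest w (n : ℂ))
    (hf : ∃ p, (fOp ^ p) w = 0) {j k : ℕ} (hj : n + 2 * k < j) : (fOp ^ j) ((eBar ^ k) w) = 0 :=
  Module.End.pow_map_zero_of_le hj
    ((hw.eBar_pow k).pow_succ_eq_zero (exists_f_pow_eBar_pow_eq_zero hf k))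

end LocallyNilpotent

section Strings

/-- The span of the vectors `fʲ ēᵏ w`. -/
def strings (w : M) : Submodule ℂ M :=
  Submodule.span ℂ (Set.range fun p : ℕ × ℕ => (fOp ^ p.1) ((eBar ^ p.2) w))

variable {w x : M}

lemma f_pow_eBar_pow_mem_strings (w : M) (j k : ℕ) : (fOp ^ j) ((eBar ^ k) w) ∈ strings w :=
  Submodule.subset_span ⟨(j, k), rfl⟩

lemma eBar_pow_mem_strings (w : M) (k : ℕ) : (eBar ^ k) w ∈ strings w :=
  f_pow_eBar_pow_mem_strings w 0 k

lemma self_mem_strings (w : M) : w ∈ strings w := eBar_pow_mem_strings w 0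

lemma strings_le {S : Submodule ℂ M} (hf : ∀ x ∈ S, fOp x ∈ S)
    (he : ∀ k, (eBar ^ k) w ∈ S) : strings w ≤ S := by
  rw [strings, Submodule.span_le]
  rintro _ ⟨⟨j, k⟩, rfl⟩
  induction j with
  | zero => exact he k
  | succ j ih =>
    change (fOp ^ (j + 1)) ((eBar ^ k) w) ∈ S
    rw [pow_succ', Module.End.mul_apply]
    exact hf _ ih

lemma f_mem_strings (hx : x ∈ strings w) : fOp x ∈ strings w := by
  refine (Submodule.span_le (p := (strings w).comap fOp)).mpr ?_ hx
  rintro _ ⟨⟨j, k⟩, rfl⟩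
  rw [SetLike.mem_coe, Submodule.mem_comap, ← Module.End.mul_apply, ← pow_succ']
  exact f_pow_eBar_pow_mem_strings w (j + 1) k

lemma eBar_mem_strings (hh : ∀ k, hBar ((eBar ^ k) w) ∈ strings w)
    (hf : ∀ k, fBar ((eBar ^ k) w) ∈ strings w) (hx : x ∈ strings w) : eBar x ∈ strings w := by
  have hle : strings w ≤
      (strings w).comap eBar ⊓ (strings w).comap hBar ⊓ (strings w).comap fBar := by
    refine strings_le ?_ fun k => ⟨⟨?_, hh k⟩, hf k⟩
    · rintro y ⟨⟨hey, hhy⟩, hfy⟩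
      simp only [Submodule.mem_inf, Submodule.mem_comap, eBar_f, hBar_f, fBar_f]
      exact ⟨⟨add_mem (f_mem_strings hey) hhy,
        sub_mem (f_mem_strings hhy) (Submodule.smul_mem _ _ hfy)⟩, f_mem_strings hfy⟩
    · rw [SetLike.mem_coe, Submodule.mem_comap, ← Module.End.mul_apply, ← pow_succ']
      exact eBar_pow_mem_strings w (k + 1)
  exact (hle hx).1.1

namespace IsHighest

variable {n : ℕ} {c χ : ℂ}

lemma e_mem_strings (hw : IsHighest w (n : ℂ)) (hx : x ∈ strings w) : eOp x ∈ strings w := by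
  refine (Submodule.span_le (p := (strings w).comap eOp)).mpr ?_ hx
  rintro _ ⟨⟨_ | j, k⟩, rfl⟩
  · change eOp ((eBar ^ k) w) ∈ strings w
    rw [(hw.eBar_pow k).e]
    exact zero_mem _
  · change eOp ((fOp ^ (j + 1)) ((eBar ^ k) w)) ∈ strings w
    rw [(hw.eBar_pow k).e_pow]
    exact Submodule.smul_mem _ _ (f_pow_eBar_pow_mem_strings w j k)

lemma hBar_mem_strings (hw : IsHighest w (n : ℂ)) (hc : cMix w ∈ strings w) :
    hBar w ∈ strings w := by
  have hcoef : (n + 2 : ℂ) ≠ 0 := by exact_mod_cast (n + 1).succ_ne_zero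
  refine ((strings w).smul_mem_iff hcoef).mp ?_
  rw [hw.add_two_smul_hBar]
  exact sub_mem hc (Submodule.smul_mem _ _ (f_pow_eBar_pow_mem_strings w 1 1))

lemma hBar_eBar_pow_mem_strings (hw : IsHighest w (n : ℂ)) (hc : cMix w = c • w) (k : ℕ) :
    hBar ((eBar ^ k) w) ∈ strings w := by
  have hle : strings ((eBar ^ k) w) ≤ strings w := strings_le (fun _ => f_mem_strings) fun l => by
    rw [← Module.End.mul_apply, ← pow_add]
    exact eBar_pow_mem_strings w (l + k)
  refine hle ((hw.eBar_pow k).hBar_mem_strings ?_)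
  rw [map_pow_apply_of_map_apply cMix_eBar, hc, map_smul]
  exact Submodule.smul_mem _ _ (self_mem_strings _)

lemma fBar_eBar_pow_mem_strings (hw : IsHighest w (n : ℂ)) (hc : cMix w = c • w)
    (hχ : cBar w = χ • w) (k : ℕ) : fBar ((eBar ^ (k + 1)) w) ∈ strings w := by
  have hcoef : (4 * (n + 2 * k : ℕ) + 12 : ℂ) ≠ 0 := by
    exact_mod_cast (by omega : 4 * (n + 2 * k) + 12 ≠ 0)
  refine ((strings w).smul_mem_iff hcoef).mp ?_
  rw [pow_succ', Module.End.mul_apply, (hw.eBar_pow k).smul_fBar_eBar,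
    map_pow_apply_of_map_apply cBar_eBar, map_pow_apply_of_map_apply cMix_eBar, hχ, hc, map_smul,
    map_smul, map_smul, ← Module.End.mul_apply eBar, ← pow_succ']
  exact add_mem (sub_mem
    (Submodule.smul_mem _ _ (Submodule.smul_mem _ _ (eBar_pow_mem_strings w k)))
    (Submodule.smul_mem _ _ (hw.hBar_eBar_pow_mem_strings hc k)))
    (Submodule.smul_mem _ _ (f_mem_strings (hw.hBar_eBar_pow_mem_strings hc (k + 1))))

theorem smul_mem_strings (hw : IsHighest w (n : ℂ)) (hc : cMix w = c • w) (hχ : cBar w = χ • w)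
    (hf : fBar w ∈ strings w) (u : U) (hx : x ∈ strings w) : u • x ∈ strings w :=
  smul_mem_of_generators (fun _ => hw.e_mem_strings) (fun _ => f_mem_strings)
    (fun _ => eBar_mem_strings (hw.hBar_eBar_pow_mem_strings hc)
      (Nat.rec hf fun k _ => hw.fBar_eBar_pow_mem_strings hc hχ k)) u hx

lemma fBar_mem_strings (hw : IsHighest w (n : ℂ)) (hc : cMix w = c • w) (hl : lower n w = 0)
    (hf : (fOp ^ (n + 1)) w = 0) : fBar w ∈ strings w := by
  have hfh : fOp (hBar w) ∈ strings w := f_mem_strings (hw.hBar_eBar_pow_mem_strings hc 0)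
  rcases Nat.eq_zero_or_pos n with rfl | hn
  · refine ((strings w).smul_mem_iff (two_ne_zero (α := ℂ))).mp ?_
    rwa [two_smul_fBar_of_f_eq_zero (by simpa using hf)]
  · have hcoef : (n * (n + 1) : ℂ) ≠ 0 := by exact_mod_cast (Nat.mul_pos hn n.succ_pos).ne'
    refine ((strings w).smul_mem_iff hcoef).mp ?_
    rw [lower, sub_sub, sub_eq_zero] at hl
    rw [hl]
    exact add_mem (Submodule.smul_mem _ _ hfh)
      (f_mem_strings (f_pow_eBar_pow_mem_strings w 1 1))

end IsHighest

end Strings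

end HighestWeightVectors

lemma IsStringSpanned.exists_isHighest_ne_zero {V : Type*} [AddCommGroup V] [Module ℂ V]
    [Sl2Module ℂ V] [Nontrivial V]
    (hV : IsStringSpanned V) :
    ∃ (n : ℕ) (w : V), w ≠ 0 ∧ IsHighest w (n : ℂ) := by
  by_contra! hzero
  refine (bot_ne_top (α := Submodule ℂ V)) (hV ▸ (Submodule.span_eq_bot.mpr ?_).symm)
  rintro _ ⟨w, n, j, hw, -, -, rfl⟩
  rw [by_contra fun hw0 => hzero n w hw0 hw, map_zero]

section Structure

variable {V : Type*} [AddCommGroup V] [Module ℂ V] [Module U V] [IsScalarTower ℂ U V]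

section Separator

/-- An operator of which the vectors `fʲ ēᵏ w`, for a highest weight vector `w`, are eigenvectors
with pairwise distinct eigenvalues. -/
def separator : V →ₗ[ℂ] V := casimir + Complex.I • hOp

/-- The eigenvalue of `separator` at `fʲ ēᵏ w`, for `p = (j, k)` and `w` of highest weight `n`. -/
def separatorEigenvalue (n : ℕ) (p : ℕ × ℕ) : ℂ :=
  ((n + 2 * p.2 : ℕ) + 1 : ℂ) ^ 2 + Complex.I * ((n + 2 * p.2 - 2 * p.1 : ℤ) : ℂ)

lemma eq_and_eq_of_sq_add_I_mul_eq {k l : ℕ} {a b : ℤ}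
    (h : ((k : ℂ) + 1) ^ 2 + Complex.I * a = ((l : ℂ) + 1) ^ 2 + Complex.I * b) :
    k = l ∧ a = b := by
  have hre := congrArg Complex.re h
  have him := congrArg Complex.im h
  simp only [pow_two, Complex.add_re, Complex.mul_re, Complex.add_im, Complex.mul_im,
    Complex.natCast_re, Complex.natCast_im, Complex.one_re, Complex.one_im, Complex.I_re,
    Complex.I_im, Complex.intCast_re, Complex.intCast_im] at hre him
  have hkl : (k : ℝ) + 1 = l + 1 :=
    (pow_left_inj₀ (by positivity) (by positivity) two_ne_zero).mp (by linarith)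
  exact ⟨by exact_mod_cast add_right_cancel hkl, by exact_mod_cast (by linarith : (a : ℝ) = b)⟩

lemma separatorEigenvalue_injective (n : ℕ) : Function.Injective (separatorEigenvalue n) := by
  intro p q hpq
  obtain ⟨hk, hj⟩ := eq_and_eq_of_sq_add_I_mul_eq hpq
  exact Prod.ext (by omega) (by omega)

lemma IsHighest.separator_f_pow {w : V} {μ : ℂ} (hw : IsHighest w μ) (j : ℕ) :
    separator ((fOp ^ j) w) = ((μ + 1) ^ 2 + Complex.I * (μ - 2 * j)) • (fOp ^ j) w := by
  rw [separator, LinearMap.add_apply, LinearMap.smul_apply, hw.casimir_pow, hw.h_pow, add_smul,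
    mul_smul]

end Separator

namespace IsHighest

variable {v : V} {n : ℕ}

lemma mem_eigenspace_separator (hv : IsHighest v (n : ℂ)) (p : ℕ × ℕ) :
    (fOp ^ p.1) ((eBar ^ p.2) v) ∈ Module.End.eigenspace separator (separatorEigenvalue n p) := by
  rw [Module.End.mem_eigenspace_iff, (hv.eBar_pow p.2).separator_f_pow, separatorEigenvalue]
  push_cast
  rfl

lemma mem_span_eBar_pow (hv : IsHighest v (n : ℂ)) {x : V} (hx : x ∈ strings v) {N : ℕ}
    (hN : IsHighest x (N : ℂ)) :
    x ∈ Submodule.span ℂ ((fun k : ℕ => (eBar ^ k) v) '' {k | n + 2 * k = N}) := by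
  have hmem := mem_span_of_eigenvector hv.mem_eigenspace_separator hx
    (Module.End.mem_eigenspace_iff.mpr (hN.separator_f_pow 0))
  refine Submodule.span_mono ?_ hmem
  rintro _ ⟨⟨j, k⟩, hp, rfl⟩
  obtain ⟨hk, hj⟩ := eq_and_eq_of_sq_add_I_mul_eq (l := N) (b := N) (hp.trans (by push_cast; ring))
  obtain rfl : j = 0 := by omega
  exact ⟨k, hk, rfl⟩

lemma strings_eq_span (hv : IsHighest v (n : ℂ)) (hf : ∃ p, (fOp ^ p) v = 0) :
    strings v = Submodule.span ℂ (Set.range fun p : {p : ℕ × ℕ // p.1 ≤ n + 2 * p.2} =>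
      (fOp ^ p.1.1) ((eBar ^ p.1.2) v)) := by
  refine le_antisymm (Submodule.span_le.mpr ?_)
    (Submodule.span_mono (by rintro _ ⟨p, rfl⟩; exact ⟨p.1, rfl⟩))
  rintro _ ⟨p, rfl⟩
  change (fOp ^ p.1) ((eBar ^ p.2) v) ∈ _
  by_cases hp : p.1 ≤ n + 2 * p.2
  · exact Submodule.subset_span ⟨⟨p, hp⟩, rfl⟩
  · rw [hv.f_pow_eBar_pow_eq_zero hf (not_le.mp hp)]
    exact zero_mem _

lemma linearIndependent_strings (hv : IsHighest v (n : ℂ)) (hne : ∀ k : ℕ, (eBar ^ k) v ≠ 0) :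
    LinearIndependent ℂ fun p : {p : ℕ × ℕ // p.1 ≤ n + 2 * p.2} =>
      (fOp ^ p.1.1) ((eBar ^ p.1.2) v) := by
  refine Module.End.eigenvectors_linearIndependent' (separator : V →ₗ[ℂ] V)
    (fun p => separatorEigenvalue n p.1) ?_ _ fun p => ⟨?_, fun h0 => ?_⟩
  · exact fun p q hpq => Subtype.ext (separatorEigenvalue_injective n hpq)
  · exact hv.mem_eigenspace_separator p.1
  · exact hne p.1.2 ((hv.eBar_pow p.1.2).eq_zero_of_pow p.2 h0)

lemma eq_zero_of_sub_two {x : V} (hx : IsHighest x (n - 2 : ℂ))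
    (hmin : ∀ k < n, ∀ y : V, IsHighest y (k : ℂ) → y = 0) (hf : ∃ p, (fOp ^ p) x = 0) :
    x = 0 := by
  by_cases hn : 2 ≤ n
  · obtain ⟨k, rfl⟩ := Nat.exists_eq_add_of_le' hn
    exact hmin k (by omega) x (by simpa using hx)
  · refine hx.eq_zero_of_forall_ne_natCast (fun k hk => ?_) hf
    have hnk : n = k + 2 := by exact_mod_cast (eq_add_of_sub_eq hk : (n : ℂ) = k + 2)
    omega

end IsHighest

/-- `V` is spanned by the vectors `fʲ ēᵏ v`, where `v` has highest weight `n`, generates a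
finite-dimensional representation of `𝔤`, and is an eigenvector of both central elements. -/
structure IsGenerator (v : V) (n : ℕ) (c χ : ℂ) : Prop where
  highest : IsHighest v (n : ℂ)
  nilpotent : (fOp ^ (n + 1)) v = 0
  cMix : cMix v = c • v
  cBar : cBar v = χ • v
  span : strings v = ⊤

namespace IsGenerator

variable {v : V} {n : ℕ} {c χ : ℂ}

lemma isLocallyNilpotent_f (hv : IsGenerator v n c χ) :
    IsLocallyNilpotent (fOp : V →ₗ[ℂ] V) := by
  refine isLocallyNilpotent_of_span hv.span ?_
  rintro _ ⟨⟨j, k⟩, rfl⟩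
  obtain ⟨p, hp⟩ := exists_f_pow_eBar_pow_eq_zero ⟨_, hv.nilpotent⟩ k
  refine ⟨p, ?_⟩
  rw [← Module.End.mul_apply, ← pow_add]
  exact Module.End.pow_map_zero_of_le (p.le_add_right j) hp

lemma isStringSpanned (hv : IsGenerator v n c χ) : IsStringSpanned V := by
  refine top_unique (hv.span.ge.trans ?_)
  rw [hv.highest.strings_eq_span ⟨_, hv.nilpotent⟩]
  refine Submodule.span_mono ?_
  rintro _ ⟨⟨⟨j, k⟩, hp⟩, rfl⟩
  have hw := hv.highest.eBar_pow k
  exact ⟨_, n + 2 * k, j, hw, hw.pow_succ_eq_zero (hv.isLocallyNilpotent_f _), hp, rfl⟩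

lemma exists_eq_smul (hv : IsGenerator v n c χ) {x : V} (hx : IsHighest x (n : ℂ)) :
    ∃ a : ℂ, x = a • v := by
  have hmem := hv.highest.mem_span_eBar_pow (hv.span ▸ Submodule.mem_top) hx
  have hset : {k | n + 2 * k = n} = {0} := by ext; simp
  rw [hset, Set.image_singleton] at hmem
  obtain ⟨a, ha⟩ := Submodule.mem_span_singleton.mp hmem
  exact ⟨a, ha.symm⟩

lemma eq_zero_of_isHighest_lt (hv : IsGenerator v n c χ) {x : V} {k : ℕ} (hk : k < n)
    (hx : IsHighest x (k : ℂ)) : x = 0 := by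
  have hmem := hv.highest.mem_span_eBar_pow (hv.span ▸ Submodule.mem_top) hx
  have hset : {l | n + 2 * l = k} = ∅ :=
    Set.eq_empty_of_forall_notMem fun l (hl : _ = k) => by omega
  rwa [hset, Set.image_empty, Submodule.span_empty, Submodule.mem_bot] at hmem

lemma eq_zero_of_isHighest_sub_two (hv : IsGenerator v n c χ) {x : V}
    (hx : IsHighest x (n - 2 : ℂ)) : x = 0 :=
  hx.eq_zero_of_sub_two (fun _ hk _ => hv.eq_zero_of_isHighest_lt hk) (hv.isLocallyNilpotent_f x)

lemma lower_eq_zero (hv : IsGenerator v n c χ) : lower n v = 0 :=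
  hv.eq_zero_of_isHighest_sub_two hv.highest.lower

lemma sq_eq (hv : IsGenerator v n c χ) (hv0 : v ≠ 0) : c ^ 2 = n ^ 2 * χ := by
  have hn : (n + 2 : ℂ) ≠ 0 := by exact_mod_cast (n + 1).succ_ne_zero
  have hsq := hv.highest.cMix_cMix hn hv.lower_eq_zero
  rw [hv.cMix, map_smul, hv.cMix, hv.cBar, smul_smul, smul_smul, ← pow_two] at hsq
  exact smul_left_injective ℂ hv0 hsq

lemma eBar_pow_ne_zero (hv : IsGenerator v n c χ) (hinf : ¬ FiniteDimensional ℂ V)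
    (k : ℕ) : (eBar ^ k) v ≠ 0 := by
  intro hk
  have hspan : Submodule.span ℂ ((fun p : ℕ × ℕ => (fOp ^ p.1) ((eBar ^ p.2) v)) ''
      (Set.Iic (n + 2 * k) ×ˢ Set.Iio k)) = ⊤ := by
    refine top_unique (hv.span.ge.trans (Submodule.span_le.mpr ?_))
    rintro _ ⟨p, rfl⟩
    change (fOp ^ p.1) ((TakiffSl2.eBar ^ p.2) v) ∈ _
    rcases le_or_gt k p.2 with hkp | hpk
    · rw [Module.End.pow_map_zero_of_le hkp hk, map_zero]
      exact zero_mem _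
    rcases le_or_gt p.1 (n + 2 * k) with hpn | hnp
    · exact Submodule.subset_span ⟨p, ⟨hpn, hpk⟩, rfl⟩
    · rw [hv.highest.f_pow_eBar_pow_eq_zero ⟨_, hv.nilpotent⟩ (by omega)]
      exact zero_mem _
  exact hinf (Module.finite_def.mpr (hspan ▸ Submodule.fg_span
    (((Set.finite_Iic _).prod (Set.finite_Iio k)).image _)))

section Lift

variable {M : Type*} [AddCommGroup M] [Module ℂ M] [Module U M] [IsScalarTower ℂ U M]
  {i : V →ₗ[U] M} {p : M →ₗ[U] V} {m : M}

lemma lower_lift_eq_zero (hv : IsGenerator v n c χ) (hi : Function.Injective i)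
    (hip : Function.Exact i p) (hm : IsHighest m (n : ℂ)) (hp : p m = v) : lower n m = 0 := by
  obtain ⟨z, hz⟩ := (hip (lower n m)).mp (by rw [map_lower, hp, hv.lower_eq_zero])
  have hlower : IsHighest (i z) (n - 2 : ℂ) := hz ▸ hm.lower
  rw [← hz, hv.eq_zero_of_isHighest_sub_two (hlower.of_map (isSl2Hom_restrictScalars i) hi),
    map_zero]

lemma cMix_lift_eq (hv : IsGenerator v n c χ) (hv0 : v ≠ 0) (hχ : χ ≠ 0)
    (hi : Function.Injective i) (hip : Function.Exact i p) (hm : IsHighest m (n : ℂ))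
    (hf : (fOp ^ (n + 1)) m = 0) (hp : p m = v) (hc : TakiffSl2.cBar m = χ • m) :
    TakiffSl2.cMix m = c • m := by
  have hsq : c ^ 2 = n ^ 2 * χ := hv.sq_eq hv0
  rcases Nat.eq_zero_or_pos n with rfl | hn
  · have hc0 : c = 0 := by simpa using hsq
    rw [IsHighest.cMix_eq_zero (by simpa using hm) (by simpa using hf), hc0, zero_smul]
  obtain ⟨b, hb⟩ : ∃ b : ℂ, TakiffSl2.cMix m = c • m + b • i v := by
    obtain ⟨y, hy⟩ := (hip (TakiffSl2.cMix m - c • m)).mp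
      (by rw [map_sub, map_cMix, p.map_smul_of_tower, hp, hv.cMix, sub_self])
    have hiy : IsHighest (i y) (n : ℂ) := by
      rw [hy]
      exact ⟨by rw [map_sub, hm.cMix.e, map_smul, hm.e, smul_zero, sub_zero],
        by rw [map_sub, hm.cMix.h, map_smul, hm.h, smul_sub, smul_comm]⟩
    obtain ⟨b, rfl⟩ := hv.exists_eq_smul (hiy.of_map (isSl2Hom_restrictScalars i) hi)
    exact ⟨b, by rw [← i.map_smul_of_tower, hy, add_sub_cancel]⟩
  have hiv : TakiffSl2.cMix (i v) = c • i v := by rw [← map_cMix, hv.cMix, i.map_smul_of_tower]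
  have hcb : (2 * c * b) • i v = 0 := by
    have hn2 : (n + 2 : ℂ) ≠ 0 := by exact_mod_cast (n + 1).succ_ne_zero
    have hcc := hm.cMix_cMix hn2 (hv.lower_lift_eq_zero hi hip hm hp)
    rw [hb, map_add, map_smul, map_smul, hiv, hb, hc, smul_smul _ χ, ← hsq] at hcc
    linear_combination (norm := module) hcc
  have hc0 : c ≠ 0 := by
    rintro rfl
    have hn0 : (n : ℂ) ≠ 0 := by exact_mod_cast hn.ne'
    exact mul_ne_zero (pow_ne_zero 2 hn0) hχ (by rw [← hsq, zero_pow two_ne_zero])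
  have hb0 : b = 0 := (mul_eq_zero.mp ((smul_eq_zero.mp hcb).resolve_right
    ((map_ne_zero_iff i hi).mpr hv0))).resolve_left (mul_ne_zero two_ne_zero hc0)
  rw [hb, hb0, zero_smul, add_zero]

end Lift

end IsGenerator

lemma IsHighest.smul_eq_zero_of_map {M : Type*} [AddCommGroup M] [Module ℂ M] [Module U M]
    [IsScalarTower ℂ U M] {p : M →ₗ[U] V} {m : M} {n : ℕ} (hm : IsHighest m (n : ℂ))
    (hf : ∃ k, (fOp ^ k) m = 0) (hpm : IsHighest (p m) (n : ℂ))
    (hne : ∀ k : ℕ, (eBar ^ k) (p m) ≠ 0) {u : U} (hum : u • m ∈ strings m)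
    (hu : u • p m = 0) : u • m = 0 := by
  rw [hm.strings_eq_span hf] at hum
  obtain ⟨a, ha⟩ := Finsupp.mem_span_range_iff_exists_finsupp.mp hum
  have hpa := congrArg p ha
  rw [map_smul, hu, Finsupp.sum, map_sum] at hpa
  simp only [p.map_smul_of_tower, map_f_pow, map_eBar_pow] at hpa
  have hcoef := linearIndependent_iff'.mp (hpm.linearIndependent_strings hne) _ _ hpa
  rw [← ha, Finsupp.sum]
  exact Finset.sum_eq_zero fun q hq => by rw [hcoef q hq, zero_smul]

theorem IsGenerator.smul_eq_zero_of_lift {v : V} {n : ℕ} {c χ : ℂ} (hv : IsGenerator v n c χ)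
    (hne : ∀ k : ℕ, (eBar ^ k) v ≠ 0) (hχ : χ ≠ 0) {M : Type*} [AddCommGroup M] [Module ℂ M]
    [Module U M] [IsScalarTower ℂ U M] {i : V →ₗ[U] M} {p : M →ₗ[U] V}
    (hi : Function.Injective i) (hip : Function.Exact i p) {m : M} (hm : IsHighest m (n : ℂ))
    (hf : (fOp ^ (n + 1)) m = 0) (hp : p m = v) (hc : TakiffSl2.cBar m = χ • m) {u : U}
    (hu : u • v = 0) : u • m = 0 := by
  have hmix : TakiffSl2.cMix m = c • m := hv.cMix_lift_eq (hne 0) hχ hi hip hm hf hp hc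
  have hlower : lower n m = 0 := hv.lower_lift_eq_zero hi hip hm hp
  have hum : u • m ∈ strings m :=
    hm.smul_mem_strings hmix hc (hm.fBar_mem_strings hmix hlower hf) u (self_mem_strings m)
  subst hp
  exact hm.smul_eq_zero_of_map ⟨_, hf⟩ hv.highest hne hum hu

section Simple

variable [IsSimpleModule U V] {v : V} {n : ℕ} {c χ : ℂ}

lemma IsHighest.isGenerator (hv : IsHighest v (n : ℂ)) (hv0 : v ≠ 0) (hf : ∃ p, (fOp ^ p) v = 0)
    (hc : cMix v = c • v) (hχ : cBar v = χ • v) (hfv : fBar v ∈ strings v) :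
    IsGenerator v n c χ :=
  ⟨hv, hv.pow_succ_eq_zero hf, hc, hχ, eq_top_of_isSimpleModule
    (fun u _ hx => hv.smul_mem_strings hc hχ hfv u hx) (self_mem_strings v) hv0⟩

lemma IsGenerator.chi_ne_zero (hv : IsGenerator v n c χ) (hne : ∀ k : ℕ, (eBar ^ k) v ≠ 0)
    (hc : ∀ x : V, TakiffSl2.cMix x = c • x) (hχ : ∀ x : V, TakiffSl2.cBar x = χ • x) : χ ≠ 0 := by
  -- If `χ = 0`, then `c = 0` and `ē v` is another generator, of highest weight `n + 2`.
  rintro rfl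
  obtain rfl : c = 0 := by simpa using hv.sq_eq (hne 0)
  have hw : IsHighest (eBar v) ((n + 2 : ℕ) : ℂ) := hv.highest.eBar_pow 1
  have hhw : hBar (eBar v) ∈ strings (eBar v) :=
    hw.hBar_mem_strings (by rw [hc, zero_smul]; exact zero_mem _)
  have hfw : fBar (eBar v) ∈ strings (eBar v) := by
    have hcoef : (4 * n + 12 : ℂ) ≠ 0 := by exact_mod_cast (by omega : 4 * n + 12 ≠ 0)
    refine ((strings (eBar v)).smul_mem_iff hcoef).mp ?_
    rw [hv.highest.smul_fBar_eBar, hχ, hc, zero_smul, map_zero, smul_zero, sub_zero, zero_add]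
    exact Submodule.smul_mem _ _ (f_mem_strings hhw)
  have hgen : IsGenerator (eBar v) (n + 2) 0 0 :=
    hw.isGenerator (hne 1) (hv.isLocallyNilpotent_f _) (hc _) (hχ _) hfw
  exact hne 0 (hgen.eq_zero_of_isHighest_lt (by omega) hv.highest)

theorem exists_isGenerator (hV : IsStringSpanned V) (hc : ∀ x : V, cMix x = c • x)
    (hχ : ∀ x : V, cBar x = χ • x) : ∃ (v : V) (n : ℕ), IsGenerator v n c χ := by
  classical
  have := IsSimpleModule.nontrivial U V
  have hex := hV.exists_isHighest_ne_zero
  obtain ⟨v, hv0, hv⟩ := Nat.find_spec hex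
  have hmin : ∀ k < Nat.find hex, ∀ y : V, IsHighest y (k : ℂ) → y = 0 := fun k hk y hy =>
    by_contra fun hy0 => Nat.find_min hex hk ⟨y, hy0, hy⟩
  have hlower : lower (Nat.find hex) v = 0 :=
    hv.lower.eq_zero_of_sub_two hmin (hV.isLocallyNilpotent_f _)
  have hf := hV.isLocallyNilpotent_f v
  exact ⟨v, _, hv.isGenerator hv0 hf (hc v) (hχ v)
    (hv.fBar_mem_strings (hc v) hlower (hv.pow_succ_eq_zero hf))⟩

end Simple

end Structure

section Enveloping

/-- The action of `U(𝔗)` on `V` extends that of `𝔗`. -/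
class IsCompatible (V : Type*) [AddCommGroup V] [LieRingModule Takiff V] [Module U V] : Prop where
  iota_smul (t : Takiff) (x : V) : (UniversalEnvelopingAlgebra.ι ℂ t : U) • x = ⁅t, x⁆

variable (V : Type*) [AddCommGroup V] [Module ℂ V] [LieRingModule Takiff V] [LieModule ℂ Takiff V]

/-- The action of `U(𝔗)` on a `𝔗`-module, the one underlying `toModuleCat`. -/
@[reducible]
def uModule : Module U V :=
  Module.compHom V (UniversalEnvelopingAlgebra.lift ℂ (LieModule.toEnd ℂ Takiff V)).toRingHom

lemma uModule_isScalarTower : letI := uModule V; IsScalarTower ℂ U V :=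
  letI := uModule V
  ⟨fun r u x => congrArg (fun A : Module.End ℂ V => A x)
    (map_smul (UniversalEnvelopingAlgebra.lift ℂ (LieModule.toEnd ℂ Takiff V)) r u)⟩

lemma uModule_isCompatible : letI := uModule V; IsCompatible V :=
  letI := uModule V
  ⟨fun t x => congrArg (fun A : Module.End ℂ V => A x)
    (UniversalEnvelopingAlgebra.lift_ι_apply ℂ (LieModule.toEnd ℂ Takiff V) t)⟩

end Enveloping

section FiniteDimensional

lemma exists_eq_zero_of_injective_eigenvalue {K M : Type*} [Field K] [AddCommGroup M] [Module K M]
    [FiniteDimensional K M] {A : Module.End K M} {x : ℕ → M} {ν : ℕ → K}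
    (hν : Function.Injective ν) (hx : ∀ k, A (x k) = ν k • x k) : ∃ k, x k = 0 := by
  by_contra! h0
  exact Set.infinite_of_injective_forall_mem hν
    (fun k => Module.End.hasEigenvalue_of_hasEigenvector ⟨Module.End.mem_eigenspace_iff.mpr (hx k),
      h0 k⟩) (Module.End.finite_hasEigenvalue A)

lemma IsStringVector.map {K M N : Type*} [CommRing K] [AddCommGroup M] [Module K M] [Sl2Module K M]
    [AddCommGroup N] [Module K N] [Sl2Module K N] {φ : M →ₗ[K] N} (hφ : IsSl2Hom φ) {x : M}
    (hx : IsStringVector x) : IsStringVector (φ x) := by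
  obtain ⟨w, n, j, hw, hn, hj, rfl⟩ := hx
  have map_pow (k : ℕ) : φ ((fOp ^ k) w) = (fOp ^ k) (φ w) :=
    map_pow_apply_of_map_apply hφ.map_f k w
  exact ⟨φ w, n, j, hw.map hφ, by rw [← map_pow, hn, map_zero], hj, map_pow j⟩

variable {K M : Type*} [Field K] [AddCommGroup M] [Module K M] [Sl2Module K M]

lemma h_e_pow {μ : K} {m : M} (hm : hOp m = μ • m) (k : ℕ) :
    hOp ((eOp ^ k) m) = (μ + 2 * k) • (eOp ^ k) m := by
  induction k with
  | zero => simpa using hm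
  | succ k ih =>
    rw [pow_succ', Module.End.mul_apply, h_e, ih, map_smul]
    push_cast
    module

lemma map_mem_span_isStringVector {g : M →ₗ[K] M} (hg : ∀ (w : M) (n j : ℕ), IsHighest w (n : K) →
      (fOp ^ (n + 1)) w = 0 → j ≤ n → ∃ (r : K) (k : ℕ), g ((fOp ^ j) w) = r • (fOp ^ k) w) {x : M}
    (hx : x ∈ Submodule.span K {x : M | IsStringVector x}) :
    g x ∈ Submodule.span K {x : M | IsStringVector x} := by
  induction hx using Submodule.span_induction with
  | zero => rw [map_zero]; exact zero_mem _
  | add x y _ _ hx hy => rw [map_add]; exact add_mem hx hy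
  | smul r x _ hx => rw [map_smul]; exact Submodule.smul_mem _ r hx
  | mem x hx =>
    obtain ⟨w, n, j, hw, hn, hj, rfl⟩ := hx
    obtain ⟨r, k, hk⟩ := hg w n j hw hn hj
    rw [hk]
    refine Submodule.smul_mem _ r ?_
    rcases le_or_gt k n with hkn | hkn
    · exact Submodule.subset_span ⟨w, n, k, hw, hn, hkn, rfl⟩
    · rw [Module.End.pow_map_zero_of_le hkn hn]
      exact zero_mem _

variable [CharZero K] [IsAlgClosed K] [FiniteDimensional K M] [Nontrivial M]

variable (M) in
lemma exists_isHighest_natCast :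
    ∃ (w : M) (n : ℕ), w ≠ 0 ∧ IsHighest w (n : K) ∧ (fOp ^ (n + 1)) w = 0 := by
  classical
  obtain ⟨ν, hν⟩ := Module.End.exists_eigenvalue (hOp : Module.End K M)
  obtain ⟨v, hv⟩ := hν.exists_hasEigenvector
  have hev : ∃ k, (eOp ^ k) v = 0 := exists_eq_zero_of_injective_eigenvalue
    (ν := fun k => ν + 2 * k) (fun a b hab => by simpa using hab) (h_e_pow hv.apply_eq_smul)
  obtain ⟨k, hk⟩ : ∃ k, Nat.find hev = k + 1 :=
    Nat.exists_eq_succ_of_ne_zero fun h0 => hv.2 (by simpa [h0] using Nat.find_spec hev)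
  have hw0 : (eOp ^ k) v ≠ 0 := Nat.find_min hev (by omega)
  have hw : IsHighest ((eOp ^ k) v) (ν + 2 * k) :=
    ⟨by rw [← Module.End.mul_apply, ← pow_succ', ← hk]; exact Nat.find_spec hev,
      h_e_pow hv.apply_eq_smul k⟩
  have hf : ∃ p, (fOp ^ p) ((eOp ^ k) v) = 0 := exists_eq_zero_of_injective_eigenvalue
    (ν := fun j => ν + 2 * k - 2 * j) (fun a b hab => by simpa using hab) hw.h_pow
  obtain ⟨n, hn⟩ : ∃ n : ℕ, ν + 2 * k = n := by
    by_contra! hne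
    exact hw0 (hw.eq_zero_of_forall_ne_natCast hne hf)
  rw [hn] at hw
  exact ⟨_, n, hw0, hw, hw.pow_succ_eq_zero hf⟩

theorem IsStringSpanned.of_irreducible
    (hM : ∀ T : Submodule K M, (∀ x ∈ T, eOp x ∈ T) → (∀ x ∈ T, fOp x ∈ T) →
      (∀ x ∈ T, hOp x ∈ T) → T = ⊥ ∨ T = ⊤) : IsStringSpanned M := by
  refine (hM (Submodule.span K {x : M | IsStringVector x})
    (fun x => map_mem_span_isStringVector fun w n j hw _ _ => ?_)
    (fun x => map_mem_span_isStringVector fun w n j _ _ _ => ⟨1, j + 1, ?_⟩)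
    (fun x => map_mem_span_isStringVector fun w n j hw _ _ => ⟨_, j, hw.h_pow j⟩)).resolve_left ?_
  · rcases j with _ | j
    · exact ⟨0, 0, by simp [hw.e]⟩
    · exact ⟨_, j, hw.e_pow j⟩
  · rw [one_smul, pow_succ', Module.End.mul_apply]
  · obtain ⟨w, n, hw0, hw, hn⟩ := exists_isHighest_natCast M
    exact fun hbot => hw0 ((Submodule.span_eq_bot.mp hbot) w ⟨w, n, 0, hw, hn, n.zero_le, rfl⟩)

end FiniteDimensional

section HarishChandra

/-- The isomorphism `v ↦ v ⊗ 1` from `𝔤` to the subalgebra `𝔤 ⊗ 1` of `𝔗`. -/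
def toGSub : Sl2 →ₗ⁅ℂ⁆ gSub := incl.rangeRestrict

/-- The `𝔰𝔩₂`-representation underlying a module over the subalgebra `𝔤` of `𝔗`. -/
@[reducible]
def Sl2Module.ofGSub (W : Type*) [AddCommGroup W] [Module ℂ W] [LieRingModule gSub W]
    [LieModule ℂ gSub W] : Sl2Module ℂ W where
  eOp := LieModule.toEnd ℂ gSub W (toGSub e)
  fOp := LieModule.toEnd ℂ gSub W (toGSub f)
  hOp := LieModule.toEnd ℂ gSub W (toGSub h)
  e_f m := by
    simp only [LieModule.toEnd_apply_apply]
    rw [leibniz_lie, ← LieHom.map_lie, lie_e_f, add_comm]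
  h_e m := by
    simp only [LieModule.toEnd_apply_apply]
    rw [leibniz_lie, ← LieHom.map_lie, lie_h_e, map_smul, smul_lie, add_comm]
  h_f m := by
    simp only [LieModule.toEnd_apply_apply]
    rw [leibniz_lie, ← LieHom.map_lie, lie_h_f, map_smul, smul_lie, neg_smul, neg_add_eq_sub]

lemma isStringSpanned_of_isIrreducible_gSub (W : Type*) [AddCommGroup W] [Module ℂ W]
    [LieRingModule gSub W] [LieModule ℂ gSub W] [LieModule.IsIrreducible ℂ gSub W]
    [FiniteDimensional ℂ W] : letI := Sl2Module.ofGSub W; IsStringSpanned W := by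
  let _ := Sl2Module.ofGSub W
  have := LieModule.nontrivial_of_isIrreducible ℂ gSub W
  refine IsStringSpanned.of_irreducible fun T he hf hh => ?_
  let T' : LieSubmodule ℂ gSub W :=
    { T with
      lie_mem := by
        rintro ⟨_, a, rfl⟩ m hm
        obtain ⟨x, y, z, rfl⟩ := sl2_decomp a
        change ⁅toGSub (x • f + y • h + z • e), m⁆ ∈ T
        simp only [map_add, map_smul, add_lie, smul_lie]
        exact add_mem (add_mem (T.smul_mem x (hf m hm)) (T.smul_mem y (hh m hm)))
          (T.smul_mem z (he m hm)) }
  exact (eq_bot_or_eq_top T').imp (congrArg LieSubmodule.toSubmodule)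
    (congrArg LieSubmodule.toSubmodule)

variable {V : Type*} [AddCommGroup V] [Module ℂ V] [Module U V]
  [LieRingModule Takiff V] [IsCompatible V]

theorem IsHarishChandra.isStringSpanned [IsScalarTower ℂ U V] [LieModule ℂ Takiff V]
    (hV : IsHarishChandra V) : IsStringSpanned V := by
  obtain ⟨𝒮, -, htop, hirr, -⟩ := hV
  refine top_unique ?_
  rw [← LieSubmodule.top_toSubmodule (R := ℂ) (L := gSub) (M := V), ← htop,
    LieSubmodule.sSup_toSubmodule]
  refine sSup_le ?_
  rintro _ ⟨S, hS, rfl⟩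
  obtain ⟨_, _⟩ := hirr S hS
  let _ := Sl2Module.ofGSub S
  have map_op (a : Sl2) (x : S) : ((⁅toGSub a, x⁆ : S) : V) = uIncl a • (x : V) :=
    (IsCompatible.iota_smul (incl a) (x : V)).symm
  have hsub : IsSl2Hom S.toSubmodule.subtype := ⟨map_op e, map_op f, map_op h⟩
  have hspan : Submodule.span ℂ {x : S | IsStringVector x} = ⊤ :=
    isStringSpanned_of_isIrreducible_gSub S
  rw [← S.toSubmodule.range_subtype, LinearMap.range_eq_map, ← hspan, Submodule.map_span]
  exact Submodule.span_mono (Set.image_subset_iff.mpr fun x hx => hx.map hsub)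

lemma isSimpleModule_of_isIrreducible [IsScalarTower ℂ U V]
    (hV : LieModule.IsIrreducible ℂ Takiff V) : IsSimpleModule U V := by
  have := LieModule.nontrivial_of_isIrreducible ℂ Takiff V
  refine { toIsSimpleOrder := { eq_bot_or_eq_top := fun S => ?_ } }
  let S' : LieSubmodule ℂ Takiff V :=
    { S.restrictScalars ℂ with
      lie_mem := fun {t m} hm => by rw [← IsCompatible.iota_smul]; exact S.smul_mem _ hm }
  refine (eq_bot_or_eq_top S').imp (fun hS => ?_) (fun hS => ?_)
  · exact (Submodule.restrictScalars_eq_bot_iff ..).mp (congrArg LieSubmodule.toSubmodule hS)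
  · exact (Submodule.restrictScalars_eq_top_iff ..).mp (congrArg LieSubmodule.toSubmodule hS)

end HarishChandra

section Euler

lemma iota_eq (t : Takiff) :
    (UniversalEnvelopingAlgebra.ι ℂ t : U) = uIncl (even t) + uBar (odd t) := by
  conv_lhs => rw [← incl_even_add_bar_odd t, map_add]
  rfl

lemma uBar_odd_lie (s t : Takiff) : uBar (odd ⁅s, t⁆) =
    UniversalEnvelopingAlgebra.ι ℂ s * uBar (odd t) +
        uBar (odd s) * UniversalEnvelopingAlgebra.ι ℂ t -
      (UniversalEnvelopingAlgebra.ι ℂ t * uBar (odd s) +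
        uBar (odd t) * UniversalEnvelopingAlgebra.ι ℂ s) := by
  rw [odd_lie, uBar_add, uBar_lie, uBar_lie', iota_eq, iota_eq]
  linear_combination (norm := noncomm_ring) uBar_comm (odd t) (odd s) - uBar_comm (odd s) (odd t)

attribute [local instance 100] LieRing.ofAssociativeRing in
/-- The algebra homomorphism `u ↦ u + ε D u`, where `D` is the derivation of `U(𝔗)` that extends
the derivation `v + w̄ ↦ w̄` of `𝔗`. -/
def eulerHom : U →ₐ[ℂ] DualNumber U :=
  UniversalEnvelopingAlgebra.lift ℂ
    { toFun := fun t => TrivSqZeroExt.inl (UniversalEnvelopingAlgebra.ι ℂ t) +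
        TrivSqZeroExt.inr (uBar (odd t))
      map_add' := fun s t => by
        ext <;> simp [uBar_add]
      map_smul' := fun r t => by
        ext <;> simp [uBar_smul]
      map_lie' := fun {s t} => by
        ext
        · simp [LieRing.of_associative_ring_bracket]
        · simp [uBar_odd_lie, LieRing.of_associative_ring_bracket] }

attribute [local instance 100] LieRing.ofAssociativeRing in
lemma eulerHom_iota (t : Takiff) : eulerHom (UniversalEnvelopingAlgebra.ι ℂ t) =
    TrivSqZeroExt.inl (UniversalEnvelopingAlgebra.ι ℂ t) + TrivSqZeroExt.inr (uBar (odd t)) :=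
  UniversalEnvelopingAlgebra.lift_ι_apply ℂ _ t

lemma eulerHom_fst (u : U) : (eulerHom u).fst = u := by
  induction u using U_induction with
  | algebraMap r => rw [AlgHom.commutes]; rfl
  | iota t => rw [eulerHom_iota, TrivSqZeroExt.fst_add, TrivSqZeroExt.fst_inl,
      TrivSqZeroExt.fst_inr, add_zero]
  | mul a b ha hb => rw [map_mul, TrivSqZeroExt.fst_mul, ha, hb]
  | add a b ha hb => rw [map_add, TrivSqZeroExt.fst_add, ha, hb]

lemma eulerHom_snd_mul (a b : U) :
    (eulerHom (a * b)).snd = a * (eulerHom b).snd + (eulerHom a).snd * b := by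
  simp [TrivSqZeroExt.snd_mul, eulerHom_fst]

lemma eulerHom_snd_uBar (a : Sl2) : (eulerHom (uBar a)).snd = uBar a := by
  rw [uBar, eulerHom_iota, odd_bar, TrivSqZeroExt.snd_add, TrivSqZeroExt.snd_inl,
    TrivSqZeroExt.snd_inr, zero_add, uBar]

lemma eulerHom_snd_Cbar : (eulerHom Cbar).snd = 2 * Cbar := by
  have h4 : (eulerHom (4 : U)).snd = 0 := by rw [map_ofNat]; rfl
  simp only [Cbar, map_add, TrivSqZeroExt.snd_add, pow_two, eulerHom_snd_mul, eulerHom_snd_uBar, h4]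
  noncomm_ring

variable {V : Type*} [AddCommGroup V] [Module U V]

open Ideal (torsionOf) in
/-- The homomorphism `k ↦ (D k) v` on the annihilator of `v`, where `D` is the derivation of
`U(𝔗)` in `eulerHom`. -/
def eulerTorsion (v : V) : torsionOf U V v →ₗ[U] V where
  toFun k := (eulerHom k).snd • v
  map_add' a b := by
    rw [Submodule.coe_add, map_add, TrivSqZeroExt.snd_add, add_smul]
  map_smul' a b := by
    have hb : (b : U) • v = 0 := b.2
    rw [Submodule.coe_smul, smul_eq_mul, eulerHom_snd_mul, add_smul, mul_smul, mul_smul, hb,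
      smul_zero, add_zero, RingHom.id_apply]

end Euler

section SelfExt

open CategoryTheory Abelian
open Ideal (torsionOf)

variable {V : Type*} [AddCommGroup V] [Module ℂ V] [Module U V] [IsScalarTower ℂ U V]

lemma Cbar_sub_smul (χ : ℂ) (x : V) : (Cbar - algebraMap ℂ U χ) • x = cBar x - χ • x := by
  rw [sub_smul, algebraMap_smul, cBar_apply]

lemma uIncl_h_sub_smul (μ : ℂ) (x : V) :
    (uIncl h - algebraMap ℂ U μ) • x = hOp x - μ • x := by
  rw [sub_smul, algebraMap_smul, hOp_apply]

lemma commute_uIncl_Cbar_sub (a : Sl2) (χ : ℂ) : Commute (uIncl a) (Cbar - algebraMap ℂ U χ) :=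
  Commute.sub_right (Cbar_comm a) (Algebra.commutes χ _).symm

variable {v : V} {n : ℕ} {χ : ℂ} {z : torsionOf U V v}

lemma IsHighest.map_torsionOf {μ : ℂ} (hv : IsHighest v μ) (hχ : ∀ x : V, cBar x = χ • x)
    (hz : (z : U) = Cbar - algebraMap ℂ U χ) (φ : torsionOf U V v →ₗ[U] V) :
    IsHighest (φ z) μ := by
  have smul_map_eq_zero {r : U} (hrv : r • v = 0) (hr : Commute r (Cbar - algebraMap ℂ U χ)) :
      r • φ z = 0 := by
    have hrz : r • z = (z : U) • (⟨r, hrv⟩ : torsionOf U V v) :=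
      Subtype.ext (by change r * (z : U) = z * r; rw [hz]; exact hr)
    rw [← map_smul, hrz, map_smul, hz, Cbar_sub_smul, hχ, sub_self]
  refine ⟨smul_map_eq_zero hv.e (commute_uIncl_Cbar_sub _ χ), sub_eq_zero.mp ?_⟩
  rw [← uIncl_h_sub_smul]
  refine smul_map_eq_zero ?_ ((commute_uIncl_Cbar_sub _ χ).sub_left (Algebra.commutes μ _))
  rw [uIncl_h_sub_smul, hv.h, sub_self]

lemma eulerTorsion_ne_zero (hχ : cBar v = χ • v) (hχ0 : χ ≠ 0) (hv0 : v ≠ 0)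
    (hz : (z : U) = Cbar - algebraMap ℂ U χ) : eulerTorsion v z ≠ 0 := by
  have hD : (eulerHom z).snd = (2 : ℂ) • Cbar := by
    have hD_scalar : (eulerHom (algebraMap ℂ U χ)).snd = 0 := by rw [AlgHom.commutes]; rfl
    rw [hz, map_sub, TrivSqZeroExt.snd_sub, eulerHom_snd_Cbar, hD_scalar, sub_zero, two_mul,
      two_smul]
  have hDv : eulerTorsion v z = (2 * χ) • v := by
    rw [mul_smul, ← hχ, cBar_apply, ← smul_assoc, ← hD]; rfl
  rw [hDv]
  exact smul_ne_zero (mul_ne_zero two_ne_zero hχ0) hv0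

/-- If `φ` kills `C̄ - χ`, the canonical generator of the pushout along `φ` can be corrected to a
highest weight vector that satisfies all relations of `v`, so the pushout splits. -/
lemma IsGenerator.exists_map_eq_smul {c : ℂ} (hv : IsGenerator v n c χ)
    (hne : ∀ k : ℕ, (eBar ^ k) v ≠ 0) (hχ0 : χ ≠ 0) (hχ : ∀ x : V, TakiffSl2.cBar x = χ • x)
    (hz : (z : U) = Cbar - algebraMap ℂ U χ) {φ : torsionOf U V v →ₗ[U] V} (hφ : φ z = 0) :
    ∃ x : V, ∀ k : torsionOf U V v, φ k = (k : U) • x := by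
  have hi := isSl2Hom_restrictScalars (pushoutInl φ)
  have hnil : IsLocallyNilpotent (fOp : Pushout φ →ₗ[ℂ] Pushout φ) :=
    .of_exact hi.map_f (isSl2Hom_restrictScalars (pushoutProj φ)).map_f (pushout_exact φ)
      hv.isLocallyNilpotent_f hv.isLocallyNilpotent_f
  have smul_one {r : U} (hr : r • v = 0) : pushoutInl φ (φ ⟨r, hr⟩) = r • pushoutOne φ :=
    (smul_pushoutOne_of_mem_torsionOf φ ⟨r, hr⟩).symm
  have hh : (uIncl TakiffSl2.h - algebraMap ℂ U n) • v = 0 := by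
    rw [uIncl_h_sub_smul, hv.highest.h, sub_self]
  obtain ⟨x, hx, hfx⟩ := hv.isStringSpanned.exists_highest_lift hi (pushoutInl_injective φ) hnil
    ⟨_, smul_one hv.highest.e⟩ ⟨_, (smul_one hh).trans (uIncl_h_sub_smul _ _)⟩
  have hproj : pushoutProj φ (pushoutOne φ - pushoutInl φ x) = v := by
    rw [map_sub, pushoutProj_one, (pushout_exact φ).apply_apply_eq_zero, sub_zero]
  have hC : TakiffSl2.cBar (pushoutOne φ - pushoutInl φ x) =
      χ • (pushoutOne φ - pushoutInl φ x) := by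
    rw [← sub_eq_zero, ← Cbar_sub_smul, smul_sub, ← map_smul, Cbar_sub_smul χ x, hχ, sub_self,
      map_zero, sub_zero, ← hz, smul_pushoutOne_of_mem_torsionOf, hφ, map_zero]
  refine ⟨x, fun k => pushoutInl_injective φ ?_⟩
  have hk : (k : U) • (pushoutOne φ - pushoutInl φ x) = 0 :=
    hv.smul_eq_zero_of_lift hne hχ0 (pushoutInl_injective φ) (pushout_exact φ) hx hfx hproj hC k.2
  rwa [smul_sub, sub_eq_zero, smul_pushoutOne_of_mem_torsionOf, ← map_smul] at hk

theorem IsGenerator.ext_self [IsSimpleModule U V] {c : ℂ} (hv : IsGenerator v n c χ)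
    (hne : ∀ k : ℕ, (eBar ^ k) v ≠ 0) (hχ0 : χ ≠ 0) (hχ : ∀ x : V, TakiffSl2.cBar x = χ • x) :
    Nonempty (Ext (ModuleCat.of U V) (ModuleCat.of U V) 1 ≃ₗ[ℂ] ℂ) := by
  have hz (x : V) : (Cbar - algebraMap ℂ U χ) • x = 0 := by rw [Cbar_sub_smul, hχ, sub_self]
  refine ext_self_equiv (V := ModuleCat.of U V)
    (IsSimpleModule.toSpanSingleton_surjective U (hne 0)) ⟨_, hz v⟩ hz (fun φ => ?_)
    ⟨eulerTorsion v, eulerTorsion_ne_zero (hχ v) hχ0 (hne 0) rfl⟩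
    (fun φ hφ => hv.exists_map_eq_smul hne hχ0 hχ rfl hφ)
  obtain ⟨r, hr⟩ := hv.exists_eq_smul (hv.highest.map_torsionOf (z := ⟨_, hz v⟩) hχ rfl φ)
  exact ⟨r, hr.trans (algebraMap_smul U r v).symm⟩

lemma exists_eq_smul_of_commute [IsSimpleModule U V] {A : V →ₗ[ℂ] V}
    (he : ∀ x, A (eOp x) = eOp (A x)) (hf : ∀ x, A (fOp x) = fOp (A x))
    (hb : ∀ x, A (eBar x) = eBar (A x)) : ∃ r : ℂ, ∀ x, A x = r • x := by
  have map_smul (u : U) (x : V) : A (u • x) = u • A x := by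
    have hgraph : u • (x, A x) ∈ A.graph := by
      refine smul_mem_of_generators (fun m hm => ?_) (fun m hm => ?_) (fun m hm => ?_) u
        ((LinearMap.mem_graph_iff A _).mpr rfl)
      all_goals rw [LinearMap.mem_graph_iff] at hm ⊢
      · exact (congrArg eOp hm).trans (he _).symm
      · exact (congrArg fOp hm).trans (hf _).symm
      · exact (congrArg eBar hm).trans (hb _).symm
    exact ((LinearMap.mem_graph_iff A _).mp hgraph).symm
  exact exists_eq_smul { toFun := A, map_add' := A.map_add, map_smul' := map_smul }

theorem ext_self_of_isHarishChandra (V : Type*) [AddCommGroup V] [Module ℂ V]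
    [LieRingModule Takiff V] [LieModule ℂ Takiff V] (hV : IsHarishChandra V)
    (hirr : LieModule.IsIrreducible ℂ Takiff V) (hinf : ¬ FiniteDimensional ℂ V) :
    Nonempty (Ext (toModuleCat V) (toModuleCat V) 1 ≃ₗ[ℂ] ℂ) := by
  let _ := uModule V
  have := uModule_isScalarTower V
  have := uModule_isCompatible V
  have := isSimpleModule_of_isIrreducible hirr
  obtain ⟨c, hc⟩ := exists_eq_smul_of_commute (V := V) cMix_e cMix_f cMix_eBar
  obtain ⟨χ, hχ⟩ := exists_eq_smul_of_commute (V := V) cBar_e cBar_f cBar_eBar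
  obtain ⟨v, n, hv⟩ := exists_isGenerator hV.isStringSpanned hc hχ
  have hne := hv.eBar_pow_ne_zero hinf
  exact hv.ext_self hne (hv.chi_ne_zero hne hc hχ) hχ

end SelfExt

section Compatible

variable {M N : Type*} [AddCommGroup M] [Module ℂ M] [Module U M] [IsScalarTower ℂ U M]
  [AddCommGroup N] [Module ℂ N] [Module U N] [IsScalarTower ℂ U N]

/-- A `ℂ`-linear map that commutes with the action of `𝔗`, as a homomorphism of `U(𝔗)`-modules. -/
def ofMapIotaSMul (A : M →ₗ[ℂ] N) (hA : ∀ (t : Takiff) (x : M),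
    A ((UniversalEnvelopingAlgebra.ι ℂ t : U) • x) = (UniversalEnvelopingAlgebra.ι ℂ t : U) • A x) :
    M →ₗ[U] N where
  toFun := A
  map_add' := A.map_add
  map_smul' u x := by
    change A (u • x) = u • A x
    induction u using U_induction generalizing x with
    | algebraMap r => rw [algebraMap_smul, algebraMap_smul, map_smul]
    | iota t => exact hA t x
    | mul a b ha hb => rw [mul_smul, mul_smul, ha, hb]
    | add a b ha hb => rw [add_smul, add_smul, map_add, ha, hb]

variable [LieRingModule Takiff M] [LieModule ℂ Takiff M] [IsCompatible M]
  [LieRingModule Takiff N] [LieModule ℂ Takiff N] [IsCompatible N]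

/-- A homomorphism of `𝔗`-modules as a homomorphism of `U(𝔗)`-modules. -/
def toULinear (φ : M →ₗ⁅ℂ,Takiff⁆ N) : M →ₗ[U] N :=
  ofMapIotaSMul φ fun t x => by
    rw [IsCompatible.iota_smul, IsCompatible.iota_smul]
    exact φ.map_lie t x

/-- A homomorphism of `U(𝔗)`-modules as a homomorphism of `𝔗`-modules. -/
def toLieHom (φ : M →ₗ[U] N) : M →ₗ⁅ℂ,Takiff⁆ N where
  toLinearMap := φ.restrictScalars ℂ
  map_lie' {t x} := by
    change φ ⁅t, x⁆ = ⁅t, φ x⁆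
    rw [← IsCompatible.iota_smul, ← IsCompatible.iota_smul, map_smul]

/-- An isomorphism of `U(𝔗)`-modules as an isomorphism of `𝔗`-modules. -/
def toLieEquiv (φ : M ≃ₗ[U] N) : M ≃ₗ⁅ℂ,Takiff⁆ N :=
  { toLieHom φ.toLinearMap with
    invFun := φ.symm
    left_inv := φ.symm_apply_apply
    right_inv := φ.apply_symm_apply }

end Compatible

section Polynomial

open MvPolynomial

/-- The standard basis `f, h, e` of `𝔰𝔩₂`, indexing the variables of the polynomial ring in
`f̄, h̄, ē`. -/
def stdBasis : Fin 3 → Sl2 := ![f, h, e]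

lemma ext_stdBasis {W : Type*} [AddCommGroup W] [Module ℂ W] {g g' : Sl2 →ₗ[ℂ] W}
    (hg : ∀ i, g (stdBasis i) = g' (stdBasis i)) : g = g' := by
  ext a
  obtain ⟨x, y, z, rfl⟩ := sl2_decomp a
  have hf : g f = g' f := hg 0
  have hh : g h = g' h := hg 1
  have he : g e = g' e := hg 2
  simp only [map_add, map_smul, hf, hh, he]

/-- An element of `𝔰𝔩₂` as a linear polynomial in the standard basis. -/
def linearForm : Sl2 →ₗ[ℂ] MvPolynomial (Fin 3) ℂ where
  toFun a := a.1 1 0 • X 0 + a.1 0 0 • X 1 + a.1 0 1 • X 2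
  map_add' a b := by
    change (a.1 1 0 + b.1 1 0) • X 0 + (a.1 0 0 + b.1 0 0) • X 1 + (a.1 0 1 + b.1 0 1) • X 2 = _
    simp only [add_smul]
    abel
  map_smul' r a := by
    change (r * a.1 1 0) • X 0 + (r * a.1 0 0) • X 1 + (r * a.1 0 1) • X 2 = _
    simp only [mul_smul, smul_add, RingHom.id_apply]

lemma linearForm_apply (a : Sl2) :
    linearForm a = a.1 1 0 • X 0 + a.1 0 0 • X 1 + a.1 0 1 • X 2 := rfl

lemma linearForm_stdBasis (i : Fin 3) : linearForm (stdBasis i) = X i := by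
  have h_val : (stdBasis i).1 = ![Matrix.single 1 0 1,
      Matrix.single 0 0 1 - Matrix.single 1 1 1, Matrix.single 0 1 1] i := by
    fin_cases i <;> rfl
  rw [linearForm_apply, h_val]
  fin_cases i <;> simp

lemma mkDerivation_lie_linearForm (a b : Sl2) :
    mkDerivation ℂ (fun i => linearForm ⁅a, stdBasis i⁆) (linearForm b) = linearForm ⁅a, b⁆ := by
  have h_eq : (mkDerivation ℂ fun i => linearForm ⁅a, stdBasis i⁆).toLinearMap ∘ₗ linearForm =
      linearForm ∘ₗ (LieAlgebra.ad ℂ Sl2 a : Sl2 →ₗ[ℂ] Sl2) := ext_stdBasis fun i => by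
    change mkDerivation ℂ _ (linearForm (stdBasis i)) = linearForm ⁅a, stdBasis i⁆
    rw [linearForm_stdBasis, mkDerivation_X]
  exact LinearMap.congr_fun h_eq b

/-- The adjoint action of `𝔰𝔩₂`, extended to polynomials by derivations. -/
def adDerivation :
    Sl2 →ₗ⁅ℂ⁆ Derivation ℂ (MvPolynomial (Fin 3) ℂ) (MvPolynomial (Fin 3) ℂ) where
  toFun a := mkDerivation ℂ fun i => linearForm ⁅a, stdBasis i⁆
  map_add' a b := derivation_ext fun i => by
    simp only [Derivation.add_apply, mkDerivation_X, add_lie, map_add]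
  map_smul' r a := derivation_ext fun i => by
    simp only [Derivation.smul_apply, mkDerivation_X, smul_lie, map_smul, RingHom.id_apply]
  map_lie' {a b} := derivation_ext fun i => by
    rw [Derivation.commutator_apply, mkDerivation_X, mkDerivation_X, mkDerivation_X,
      mkDerivation_lie_linearForm, mkDerivation_lie_linearForm, ← map_sub, lie_lie]

lemma adDerivation_linearForm (a b : Sl2) :
    adDerivation a (linearForm b) = linearForm ⁅a, b⁆ := mkDerivation_lie_linearForm a b

attribute [local instance 100] LieRing.ofAssociativeRing in
/-- The representation of `𝔗` on polynomials in `f̄, h̄, ē` in which `𝔤` acts by the adjoint action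
and `𝔤̄` by multiplication. -/
def polyRep : Takiff →ₗ⁅ℂ⁆ Module.End ℂ (MvPolynomial (Fin 3) ℂ) where
  toFun t := (adDerivation (even t)).toLinearMap + LinearMap.mulLeft ℂ (linearForm (odd t))
  map_add' s t := LinearMap.ext fun p => by
    simp [add_mul, add_add_add_comm]
  map_smul' r t := LinearMap.ext fun p => by
    simp
  map_lie' {s t} := LinearMap.ext fun p => by
    change adDerivation (even ⁅s, t⁆) p + linearForm (odd ⁅s, t⁆) * p =
      (adDerivation (even s) (adDerivation (even t) p + linearForm (odd t) * p) +
        linearForm (odd s) * (adDerivation (even t) p + linearForm (odd t) * p)) -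
      (adDerivation (even t) (adDerivation (even s) p + linearForm (odd s) * p) +
        linearForm (odd t) * (adDerivation (even s) p + linearForm (odd s) * p))
    simp only [even_lie, odd_lie, LieHom.map_lie, Derivation.commutator_apply, map_add,
      Derivation.leibniz, adDerivation_linearForm, smul_eq_mul]
    rw [← lie_skew (odd s) (even t), map_neg]
    ring

attribute [local instance 100] LieRing.ofAssociativeRing in
/-- The action of `U(𝔗)` on polynomials that extends `polyRep`. -/
def polyAction : U →ₐ[ℂ] Module.End ℂ (MvPolynomial (Fin 3) ℂ) :=
  UniversalEnvelopingAlgebra.lift ℂ polyRep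

attribute [local instance 100] LieRing.ofAssociativeRing in
lemma polyAction_uBar (a : Sl2) : polyAction (uBar a) = LinearMap.mulLeft ℂ (linearForm a) := by
  refine (UniversalEnvelopingAlgebra.lift_ι_apply ℂ polyRep (bar a)).trans ?_
  change (adDerivation (even (bar a))).toLinearMap + LinearMap.mulLeft ℂ (linearForm (odd (bar a)))
    = _
  rw [even_bar, odd_bar, map_zero]
  exact zero_add _

instance : CommRing UBar :=
  { (inferInstance : Ring UBar) with
    mul_comm := fun a b => Subtype.ext (UBar_mul_comm a.2 b.2) }

/-- The homomorphism from the polynomial ring to `U(𝔤̄)`. -/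
def polyHom : MvPolynomial (Fin 3) ℂ →ₐ[ℂ] UBar :=
  aeval fun i => ⟨uBar (stdBasis i), uBar_mem _⟩

lemma polyHom_X (i : Fin 3) : polyHom (X i) = ⟨uBar (stdBasis i), uBar_mem _⟩ := aeval_X _ _

lemma polyAction_polyHom (p : MvPolynomial (Fin 3) ℂ) :
    polyAction (polyHom p) = LinearMap.mulLeft ℂ p := by
  have h_eq : (polyAction.comp UBar.val).comp polyHom = Algebra.lmul ℂ _ := algHom_ext fun i => by
    change polyAction (polyHom (X i)) = LinearMap.mulLeft ℂ (X i)
    rw [polyHom_X, polyAction_uBar, linearForm_stdBasis]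
  exact DFunLike.congr_fun h_eq p

lemma polyHom_injective : Function.Injective polyHom := fun p q hpq => by
  have h_one := LinearMap.congr_fun (congrArg (fun u : UBar => polyAction u) hpq) 1
  simpa only [polyAction_polyHom, LinearMap.mulLeft_apply, mul_one] using h_one

lemma polyHom_surjective : Function.Surjective polyHom := by
  have hle : UBar ≤ polyHom.range.map UBar.val := by
    refine Algebra.adjoin_le ?_
    rintro _ ⟨a, rfl⟩
    obtain ⟨x, y, z, rfl⟩ := sl2_decomp a
    refine ⟨polyHom (x • X 0 + y • X 1 + z • X 2), ⟨_, rfl⟩, ?_⟩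
    change UBar.val (polyHom _) = _
    simp only [map_add, map_smul, polyHom_X, uBar_add, uBar_smul]
    rfl
  intro u
  obtain ⟨_, ⟨p, rfl⟩, hp⟩ := hle u.2
  exact ⟨p, Subtype.ext hp⟩

/-- `U(𝔤̄)` is the polynomial ring in `f̄, h̄, ē`. -/
def polyEquiv : MvPolynomial (Fin 3) ℂ ≃ₐ[ℂ] UBar :=
  AlgEquiv.ofBijective polyHom ⟨polyHom_injective, polyHom_surjective⟩

instance : IsDomain UBar := polyEquiv.symm.toMulEquiv.isDomain _

/-- `C̄ - χ` as an element of `U(𝔤̄)`. -/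
def cBarSub (χ : ℂ) : UBar := ⟨Cbar, Cbar_mem⟩ - algebraMap ℂ UBar χ

lemma coe_cBarSub (χ : ℂ) : (cBarSub χ : U) = Cbar - algebraMap ℂ U χ := rfl

lemma polyHom_eq_cBarSub (χ : ℂ) :
    polyHom (X 1 ^ 2 + 4 * (X 0 * X 2) - algebraMap ℂ _ χ) = cBarSub χ := by
  simp only [map_sub, map_add, map_mul, map_pow, polyHom_X, map_ofNat, AlgHom.commutes]
  rfl

lemma exists_algHom_cBarSub (χ r : ℂ) : ∃ ψ : UBar →ₐ[ℂ] ℂ, ψ (cBarSub χ) = r := by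
  refine ⟨(aeval ![(χ + r) / 4, 0, 1]).comp polyEquiv.symm.toAlgHom, ?_⟩
  rw [← polyHom_eq_cBarSub]
  change aeval _ (polyEquiv.symm (polyEquiv _)) = r
  rw [AlgEquiv.symm_apply_apply]
  simp [mul_div_cancel₀]

lemma cBarSub_ne_zero (χ : ℂ) : cBarSub χ ≠ 0 := fun h0 => by
  obtain ⟨ψ, hψ⟩ := exists_algHom_cBarSub χ 1
  exact one_ne_zero (hψ.symm.trans ((congrArg ψ h0).trans (map_zero ψ)))

lemma not_isUnit_cBarSub (χ : ℂ) : ¬ IsUnit (cBarSub χ) := fun hu => by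
  obtain ⟨ψ, hψ⟩ := exists_algHom_cBarSub χ 0
  exact (hu.map ψ).ne_zero hψ

end Polynomial

section UBarModules

instance : Module U UBar := uModule UBar

instance : IsScalarTower ℂ U UBar := uModule_isScalarTower UBar

instance : IsCompatible UBar := uModule_isCompatible UBar

lemma coe_uIncl_smul (a : Sl2) (u : UBar) :
    ((uIncl a • u : UBar) : U) = uIncl a * u - u * uIncl a := by
  have h_zero : uBar 0 = 0 := by simp only [uBar, map_zero]
  rw [uIncl, IsCompatible.iota_smul, coe_lie, even_incl, odd_incl, h_zero, zero_mul, add_zero]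
  rfl

lemma coe_uBar_smul (a : Sl2) (u : UBar) : ((uBar a • u : UBar) : U) = uBar a * u := by
  have h_zero : uIncl 0 = 0 := by simp only [uIncl, map_zero]
  rw [uBar, IsCompatible.iota_smul, coe_lie, even_bar, odd_bar, h_zero, zero_mul, mul_zero,
    sub_zero, zero_add]
  rfl

lemma coe_smul_UBar (u v : UBar) : (u : U) • v = u * v := by
  obtain ⟨u, hu⟩ := u
  change u • v = _
  induction hu using Algebra.adjoin_induction generalizing v with
  | mem x hx =>
    obtain ⟨b, rfl⟩ := hx
    exact Subtype.ext (coe_uBar_smul b v)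
  | algebraMap r => exact (algebraMap_smul U r v).trans (Algebra.smul_def r v)
  | add x y hx hy ihx ihy =>
    rw [add_smul, ihx, ihy, ← add_mul]
    rfl
  | mul x y hx hy ihx ihy =>
    rw [mul_smul, ihy, ihx, ← mul_assoc]
    rfl

variable {χ : ℂ}

lemma commute_cBarSub (u : U) : Commute u (cBarSub χ : U) := by
  induction u using U_induction with
  | algebraMap r => exact Algebra.commutes r _
  | iota t =>
    rw [iota_eq]
    exact (commute_uIncl_Cbar_sub _ χ).add_left (UBar_mul_comm (uBar_mem _) (cBarSub χ).2)
  | mul a b ha hb => exact ha.mul_left hb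
  | add a b ha hb => exact ha.add_left hb

end UBarModules

section Invariants

variable {M : Type*} [AddCommGroup M] [Module U M]

/-- Invariance of a vector under `𝔤`. -/
def IsInvariant (m : M) : Prop := ∀ a : Sl2, uIncl a • m = 0

variable {χ : ℂ} {m : M}

lemma cBarSub_smul_smul (u : U) (m : M) :
    (cBarSub χ : U) • u • m = u • (cBarSub χ : U) • m := by
  rw [← mul_smul, ← mul_smul, (commute_cBarSub u).eq]

lemma coe_cBarSub_mul_smul (u : UBar) (m : M) :
    ((cBarSub χ * u : UBar) : U) • m = (u : U) • (cBarSub χ : U) • m := by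
  rw [MulMemClass.coe_mul, mul_smul, cBarSub_smul_smul]

lemma isInvariant_one : IsInvariant (1 : UBar) := fun a =>
  Subtype.ext (by rw [coe_uIncl_smul, OneMemClass.coe_one, mul_one, one_mul, sub_self]; rfl)

namespace IsInvariant

lemma map {N : Type*} [AddCommGroup N] [Module U N] (hm : IsInvariant m) (φ : M →ₗ[U] N) :
    IsInvariant (φ m) := fun a => by rw [← map_smul, hm, map_zero]

lemma cBarSub_smul (hm : IsInvariant m) : IsInvariant ((cBarSub χ : U) • m) := fun a => by
  rw [← cBarSub_smul_smul, hm, smul_zero]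

variable [Module ℂ M] [IsScalarTower ℂ U M]

lemma isHighest (hm : IsInvariant m) : IsHighest m ((0 : ℕ) : ℂ) :=
  ⟨hm e, by rw [Nat.cast_zero, zero_smul]; exact hm h⟩

lemma of_isHighest (hm : IsHighest m ((0 : ℕ) : ℂ)) (hf : fOp m = 0) : IsInvariant m := fun a => by
  obtain ⟨r, s, t, rfl⟩ := sl2_decomp a
  rw [uIncl_add, uIncl_add, uIncl_smul, uIncl_smul, uIncl_smul, add_smul, add_smul, smul_assoc,
    smul_assoc, smul_assoc, ← eOp_apply, ← fOp_apply, ← hOp_apply, hm.e, hm.h, hf, Nat.cast_zero,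
    zero_smul, smul_zero, smul_zero, smul_zero, add_zero, add_zero]

/-- For a `𝔤`-invariant vector `m`, the map `u ↦ u m` on `U(𝔤̄)`. -/
def orbitMap (hm : IsInvariant m) : UBar →ₗ[U] M :=
  ofMapIotaSMul (((LinearMap.toSpanSingleton U M m).restrictScalars ℂ) ∘ₗ UBar.val.toLinearMap)
    fun t u => by
      change ((UniversalEnvelopingAlgebra.ι ℂ t • u : UBar) : U) • m =
        UniversalEnvelopingAlgebra.ι ℂ t • (u : U) • m
      rw [iota_eq, add_smul, add_smul, AddMemClass.coe_add, add_smul, coe_uIncl_smul,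
        coe_uBar_smul, sub_smul, mul_smul, mul_smul, mul_smul, hm, smul_zero, sub_zero]

lemma orbitMap_apply (hm : IsInvariant m) (u : UBar) : hm.orbitMap u = (u : U) • m := rfl

lemma exists_coe_smul_eq (hm : IsInvariant m) (u : U) : ∃ v : UBar, (v : U) • m = u • m :=
  ⟨u • (1 : UBar), by
    rw [← hm.orbitMap_apply, map_smul, orbitMap_apply, OneMemClass.coe_one, one_smul]⟩

end IsInvariant

end Invariants

section Quotients

variable (χ : ℂ) (k : ℕ)

instance : Module U (UBar ⧸ powIdeal χ k) := uModule _

instance : IsScalarTower ℂ U (UBar ⧸ powIdeal χ k) := uModule_isScalarTower _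

instance : IsCompatible (UBar ⧸ powIdeal χ k) := uModule_isCompatible _

/-- The quotient map `U(𝔤̄) → U(𝔤̄) / (C̄ - χ)ᵏ`. -/
def quotMk : UBar →ₗ[U] UBar ⧸ powIdeal χ k := toULinear (LieSubmodule.Quotient.mk' _)

lemma quotMk_surjective : Function.Surjective (quotMk χ k) :=
  LieSubmodule.Quotient.surjective_mk' _

variable {χ k}

lemma quotMk_eq_zero_iff {u : UBar} : quotMk χ k u = 0 ↔ cBarSub χ ^ k ∣ u :=
  (LieSubmodule.Quotient.mk_eq_zero' (N := powIdeal χ k)).trans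
    (exists_congr fun _ => eq_comm)

lemma coe_smul_quotMk (u v : UBar) : (u : U) • quotMk χ k v = quotMk χ k (u * v) := by
  rw [← map_smul, coe_smul_UBar]

variable {M : Type*} [AddCommGroup M] [Module ℂ M] [Module U M] [IsScalarTower ℂ U M] {m : M}

/-- The map `U(𝔤̄) / (C̄ - χ)ᵏ → M` attached to a `𝔤`-invariant vector killed by `(C̄ - χ)ᵏ`. -/
def IsInvariant.quotLift (hm : IsInvariant m) (h0 : ((cBarSub χ ^ k : UBar) : U) • m = 0) :
    (UBar ⧸ powIdeal χ k) →ₗ[U] M :=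
  (LinearMap.ker (quotMk χ k)).liftQ hm.orbitMap (fun u hu => by
      obtain ⟨v, rfl⟩ := quotMk_eq_zero_iff.mp hu
      rw [LinearMap.mem_ker, hm.orbitMap_apply, mul_comm, MulMemClass.coe_mul, mul_smul, h0,
        smul_zero]) ∘ₗ
    ((quotMk χ k).quotKerEquivOfSurjective (quotMk_surjective χ k)).symm.toLinearMap

lemma IsInvariant.quotLift_quotMk (hm : IsInvariant m)
    (h0 : ((cBarSub χ ^ k : UBar) : U) • m = 0) (u : UBar) :
    hm.quotLift h0 (quotMk χ k u) = (u : U) • m :=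
  congrArg _ (LinearMap.quotKerEquivOfSurjective_symm_apply ..)

/-- An invariant vector that generates `M` and whose annihilator in `U(𝔤̄)` is generated by
`(C̄ - χ)ᵏ` identifies `U(𝔤̄) / (C̄ - χ)ᵏ` with `M`. -/
def IsInvariant.quotEquiv (hm : IsInvariant m)
    (hann : ∀ u : UBar, (u : U) • m = 0 ↔ cBarSub χ ^ k ∣ u)
    (hgen : ∀ x : M, ∃ u : UBar, (u : U) • m = x) : (UBar ⧸ powIdeal χ k) ≃ₗ[U] M :=
  LinearEquiv.ofBijective (hm.quotLift ((hann _).mpr dvd_rfl)) ⟨by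
    refine (injective_iff_map_eq_zero _).mpr fun x hx => ?_
    obtain ⟨u, rfl⟩ := quotMk_surjective χ k x
    rwa [hm.quotLift_quotMk, hann, ← quotMk_eq_zero_iff] at hx, fun x => by
    obtain ⟨u, rfl⟩ := hgen x
    exact ⟨_, hm.quotLift_quotMk _ u⟩⟩

end Quotients

section UniversalModule

variable (χ : ℂ)

instance : IsScalarTower ℂ U (Qchi χ) :=
  ⟨fun r u w => by rw [smul_Qchi, Algebra.smul_def, mul_smul]⟩

instance : IsCompatible (Qchi χ) := ⟨fun _ _ => rfl⟩

/-- The canonical generator of `Q(0, χ)`. -/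
def qOne : Qchi χ := (Q0Sub χ).mkQ ((Submodule.span U (Set.range uIncl)).mkQ 1)

lemma smul_qOne (u : U) :
    u • qOne χ = (Q0Sub χ).mkQ ((Submodule.span U (Set.range uIncl)).mkQ u) := by
  rw [← mul_one u, ← smul_eq_mul, map_smul, map_smul, smul_eq_mul, mul_one]
  rfl

lemma isInvariant_qOne : IsInvariant (qOne χ) := fun a => by
  have ha : (Submodule.span U (Set.range uIncl)).mkQ (uIncl a) = 0 :=
    (Submodule.Quotient.mk_eq_zero _).mpr (Submodule.subset_span ⟨a, rfl⟩)
  rw [smul_qOne, ha, map_zero]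
  rfl

variable {χ}

lemma cBarSub_smul_eq_zero (w : Qchi χ) : (cBarSub χ : U) • w = 0 := by
  obtain ⟨w, rfl⟩ := Submodule.mkQ_surjective _ w
  exact (Submodule.Quotient.mk_eq_zero _).mpr (Submodule.subset_span ⟨w, rfl⟩)

lemma exists_smul_qOne_eq (w : Qchi χ) : ∃ u : U, u • qOne χ = w := by
  obtain ⟨w, rfl⟩ := Submodule.mkQ_surjective _ w
  obtain ⟨u, rfl⟩ := Submodule.mkQ_surjective _ w
  exact ⟨u, smul_qOne χ u⟩

lemma exists_coe_smul_qOne_eq (w : Qchi χ) : ∃ u : UBar, (u : U) • qOne χ = w := by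
  obtain ⟨u, rfl⟩ := exists_smul_qOne_eq w
  exact (isInvariant_qOne χ).exists_coe_smul_eq u

section Lift

variable {M : Type*} [AddCommGroup M] [Module U M]

lemma qHom_ext {φ ψ : Qchi χ →ₗ[U] M} (h_one : φ (qOne χ) = ψ (qOne χ)) : φ = ψ :=
  LinearMap.ext fun w => by
    obtain ⟨u, rfl⟩ := exists_smul_qOne_eq w
    rw [map_smul, map_smul, h_one]

/-- The map `Q(0, χ) → M` attached to a `𝔤`-invariant vector killed by `C̄ - χ`. -/
def IsInvariant.qLift {m : M} (hm : IsInvariant m) (h0 : (cBarSub χ : U) • m = 0) :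
    Qchi χ →ₗ[U] M :=
  (Q0Sub χ).liftQ ((Submodule.span U (Set.range uIncl)).liftQ (LinearMap.toSpanSingleton U M m)
    (Submodule.span_le.mpr (Set.range_subset_iff.mpr hm)))
    (Submodule.span_le.mpr (Set.range_subset_iff.mpr fun w => by
      obtain ⟨u, rfl⟩ := Submodule.mkQ_surjective _ w
      change ((cBarSub χ : U) * u) • m = 0
      rw [mul_smul, cBarSub_smul_smul, h0, smul_zero]))

lemma IsInvariant.qLift_qOne {m : M} (hm : IsInvariant m) (h0 : (cBarSub χ : U) • m = 0) :
    hm.qLift h0 (qOne χ) = m := one_smul U m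

lemma IsInvariant.exists_section {m : M} {p : M →ₗ[U] Qchi χ} (hm : IsInvariant m)
    (hpm : p m = qOne χ) (h0 : (cBarSub χ : U) • m = 0) :
    ∃ s : Qchi χ →ₗ[U] M, ∀ w, p (s w) = w := by
  have h_id : p ∘ₗ hm.qLift h0 = LinearMap.id := qHom_ext (by
    rw [LinearMap.comp_apply, hm.qLift_qOne, hpm, LinearMap.id_apply])
  exact ⟨hm.qLift h0, LinearMap.congr_fun h_id⟩

end Lift

lemma smul_qOne_eq_zero_iff {u : UBar} : (u : U) • qOne χ = 0 ↔ cBarSub χ ∣ u := by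
  constructor
  · intro hu
    have hinv : IsInvariant (quotMk χ 1 1) := isInvariant_one.map _
    have h0 : (cBarSub χ : U) • quotMk χ 1 1 = 0 := by
      rw [coe_smul_quotMk, mul_one, quotMk_eq_zero_iff, pow_one]
    have h_image := congrArg (hinv.qLift h0) hu
    rwa [map_smul, map_zero, hinv.qLift_qOne, coe_smul_quotMk, mul_one, quotMk_eq_zero_iff,
      pow_one] at h_image
  · rintro ⟨v, rfl⟩
    rw [coe_cBarSub_mul_smul, cBarSub_smul_eq_zero, smul_zero]

lemma isGenerator_qOne : IsGenerator (qOne χ) 0 0 χ := by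
  have hinv := isInvariant_qOne χ
  have hf : fOp (qOne χ) = 0 := hinv f
  have hC : cMix (qOne χ) = (0 : ℂ) • qOne χ := by
    rw [zero_smul]
    exact IsHighest.cMix_eq_zero (by simpa using hinv.isHighest) hf
  have hχ : cBar (qOne χ) = χ • qOne χ := by
    rw [← sub_eq_zero, ← Cbar_sub_smul, ← coe_cBarSub, cBarSub_smul_eq_zero]
  have hl : lower (0 : ℕ) (qOne χ) = 0 := by simp [lower, hBar_eq_neg_of_f_eq_zero hf]
  have hfBar := hinv.isHighest.fBar_mem_strings hC hl (by simpa using hf)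
  refine ⟨hinv.isHighest, by simpa using hf, hC, hχ, eq_top_iff.mpr fun w _ => ?_⟩
  obtain ⟨u, rfl⟩ := exists_smul_qOne_eq w
  exact hinv.isHighest.smul_mem_strings hC hχ hfBar u (self_mem_strings _)

end UniversalModule

section CanonicalExtension

variable (χ : ℂ)

lemma cBarSub_smul_quotMk_two : (cBarSub χ : U) • quotMk χ 2 (cBarSub χ) = 0 := by
  rw [coe_smul_quotMk, quotMk_eq_zero_iff, pow_two]

lemma cBarSub_sq_smul_qOne : ((cBarSub χ ^ 2 : UBar) : U) • qOne χ = 0 := by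
  rw [pow_two, coe_cBarSub_mul_smul, cBarSub_smul_eq_zero]

lemma isInvariant_quotMk_cBarSub (k : ℕ) : IsInvariant (quotMk χ k (cBarSub χ)) := by
  rw [← mul_one (cBarSub χ), ← coe_smul_quotMk]
  exact (isInvariant_one.map _).cBarSub_smul

/-- The inclusion of `Q(0, χ)` in `U(𝔤̄) / (C̄ - χ)²`, with image generated by `C̄ - χ`. -/
def sqIncl : Qchi χ →ₗ[U] UBarModSq χ :=
  (isInvariant_quotMk_cBarSub χ 2).qLift (cBarSub_smul_quotMk_two χ)

/-- The projection of `U(𝔤̄) / (C̄ - χ)²` onto `Q(0, χ)`. -/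
def sqProj : UBarModSq χ →ₗ[U] Qchi χ :=
  (isInvariant_qOne χ).quotLift (cBarSub_sq_smul_qOne χ)

variable {χ}

lemma sqIncl_smul_qOne (u : UBar) : sqIncl χ ((u : U) • qOne χ) = quotMk χ 2 (cBarSub χ * u) := by
  rw [map_smul, sqIncl, IsInvariant.qLift_qOne, coe_smul_quotMk, mul_comm]

lemma sqProj_quotMk (u : UBar) : sqProj χ (quotMk χ 2 u) = (u : U) • qOne χ :=
  IsInvariant.quotLift_quotMk ..

lemma sqIncl_injective : Function.Injective (sqIncl χ) :=
  (injective_iff_map_eq_zero _).mpr fun w hw => by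
    obtain ⟨u, rfl⟩ := exists_coe_smul_qOne_eq w
    rwa [sqIncl_smul_qOne, quotMk_eq_zero_iff, pow_two,
      mul_dvd_mul_iff_left (cBarSub_ne_zero χ), ← smul_qOne_eq_zero_iff] at hw

lemma exact_sqIncl_sqProj : Function.Exact (sqIncl χ) (sqProj χ) := fun x => by
  obtain ⟨u, rfl⟩ := quotMk_surjective χ 2 x
  rw [sqProj_quotMk, smul_qOne_eq_zero_iff]
  constructor
  · rintro ⟨v, rfl⟩
    exact ⟨_, sqIncl_smul_qOne v⟩
  · rintro ⟨w, hw⟩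
    obtain ⟨v, rfl⟩ := exists_coe_smul_qOne_eq w
    rw [sqIncl_smul_qOne, ← sub_eq_zero, ← map_sub, quotMk_eq_zero_iff] at hw
    exact (dvd_sub_right (dvd_mul_right _ _)).mp ((dvd_pow_self _ two_ne_zero).trans hw)

lemma sqProj_surjective : Function.Surjective (sqProj χ) := fun w => by
  obtain ⟨u, rfl⟩ := exists_coe_smul_qOne_eq w
  exact ⟨_, sqProj_quotMk u⟩

/-- The image of a generator under a section would be `1 + (C̄ - χ) v` modulo `(C̄ - χ)²`, which
`C̄ - χ` does not kill. -/
lemma not_exists_section_sqProj : ¬ ∃ s : Qchi χ →ₗ[U] UBarModSq χ, ∀ w, sqProj χ (s w) = w := by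
  rintro ⟨s, hs⟩
  obtain ⟨u, hu⟩ := quotMk_surjective χ 2 (s (qOne χ))
  have h_zero : (cBarSub χ : U) • quotMk χ 2 u = 0 := by
    rw [hu, ← map_smul, cBarSub_smul_eq_zero, map_zero]
  have hu_dvd : cBarSub χ ∣ u := by
    rwa [coe_smul_quotMk, quotMk_eq_zero_iff, pow_two,
      mul_dvd_mul_iff_left (cBarSub_ne_zero χ)] at h_zero
  have hu_one : ((u - 1 : UBar) : U) • qOne χ = 0 := by
    rw [← sqProj_quotMk, map_sub, hu, map_sub, hs, sqProj_quotMk, OneMemClass.coe_one, one_smul,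
      sub_self]
  exact not_isUnit_cBarSub χ (isUnit_of_dvd_one
    ((dvd_sub_right hu_dvd).mp (smul_qOne_eq_zero_iff.mp hu_one)))

variable (χ) in
theorem exists_nonsplit : ∃ (i : Qchi χ →ₗ⁅ℂ,Takiff⁆ UBarModSq χ)
    (p : UBarModSq χ →ₗ⁅ℂ,Takiff⁆ Qchi χ), IsShortExact i p ∧ ¬ IsSplit p :=
  ⟨toLieHom (sqIncl χ), toLieHom (sqProj χ),
    ⟨sqIncl_injective, exact_sqIncl_sqProj, sqProj_surjective⟩,
    fun ⟨s, hs⟩ => not_exists_section_sqProj ⟨toULinear s, hs⟩⟩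

end CanonicalExtension

section Uniqueness

variable {χ : ℂ} {M : Type*} [AddCommGroup M] [Module ℂ M] [Module U M] [IsScalarTower ℂ U M]
  {i : Qchi χ →ₗ[U] M} {p : M →ₗ[U] Qchi χ} {m : M}

lemma exists_isInvariant_lift (hi : Function.Injective i) (hip : Function.Exact i p)
    (hp : Function.Surjective p) : ∃ m, IsInvariant m ∧ p m = qOne χ := by
  have hgen := isGenerator_qOne (χ := χ)
  have hi_sl2 := isSl2Hom_restrictScalars i
  have hnil : IsLocallyNilpotent (fOp : M →ₗ[ℂ] M) :=
    .of_exact hi_sl2.map_f (isSl2Hom_restrictScalars p).map_f hip hgen.isLocallyNilpotent_f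
      hgen.isLocallyNilpotent_f
  obtain ⟨m₀, hm₀⟩ := hp (qOne χ)
  obtain ⟨x, hx, hfx⟩ := hgen.isStringSpanned.exists_highest_lift (n := 0) hi_sl2 hi hnil
    ((hip _).mp (by rw [map_eOp, hm₀, hgen.highest.e]))
    ((hip _).mp (by rw [map_sub, map_hOp, p.map_smul_of_tower, hm₀, hgen.highest.h, sub_self]))
  refine ⟨m₀ - i x, .of_isHighest hx (by simpa using hfx), ?_⟩
  rw [map_sub, hip.apply_apply_eq_zero, sub_zero, hm₀]

lemma exists_cBarSub_smul_eq (hi : Function.Injective i) (hip : Function.Exact i p)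
    (hm : IsInvariant m) : ∃ a : ℂ, (cBarSub χ : U) • m = a • i (qOne χ) := by
  obtain ⟨y, hy⟩ := (hip ((cBarSub χ : U) • m)).mp (by rw [map_smul, cBarSub_smul_eq_zero])
  have hy_highest : IsHighest y ((0 : ℕ) : ℂ) := by
    refine .of_map (isSl2Hom_restrictScalars i) hi ?_
    change IsHighest (i y) _
    exact hy ▸ hm.cBarSub_smul.isHighest
  obtain ⟨a, rfl⟩ := isGenerator_qOne.exists_eq_smul hy_highest
  exact ⟨a, by rw [← hy, i.map_smul_of_tower]⟩

variable {a : ℂ}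

lemma cBarSub_mul_smul_eq (hma : (cBarSub χ : U) • m = a • i (qOne χ)) (v : UBar) :
    ((cBarSub χ * v : UBar) : U) • m = a • i ((v : U) • qOne χ) := by
  rw [coe_cBarSub_mul_smul, hma, smul_comm, map_smul]

lemma smul_eq_zero_iff_sq_dvd (hi : Function.Injective i) (hpm : p m = qOne χ) (ha : a ≠ 0)
    (hma : (cBarSub χ : U) • m = a • i (qOne χ)) (u : UBar) :
    (u : U) • m = 0 ↔ cBarSub χ ^ 2 ∣ u := by
  have smul_eq_zero (v : UBar) : ((cBarSub χ * v : UBar) : U) • m = 0 ↔ cBarSub χ ∣ v := by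
    rw [cBarSub_mul_smul_eq hma, smul_eq_zero_iff_right ha, map_eq_zero_iff i hi,
      smul_qOne_eq_zero_iff]
  rw [pow_two]
  constructor
  · intro hu
    obtain ⟨v, rfl⟩ := smul_qOne_eq_zero_iff.mp
      (show (u : U) • qOne χ = 0 by rw [← hpm, ← map_smul, hu, map_zero])
    exact mul_dvd_mul_left _ ((smul_eq_zero v).mp hu)
  · rintro ⟨v, rfl⟩
    rw [mul_assoc, smul_eq_zero]
    exact dvd_mul_right _ _

lemma exists_coe_smul_eq_of_exact (hip : Function.Exact i p) (hpm : p m = qOne χ) (ha : a ≠ 0)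
    (hma : (cBarSub χ : U) • m = a • i (qOne χ)) (x : M) : ∃ u : UBar, (u : U) • m = x := by
  obtain ⟨u, hu⟩ := exists_coe_smul_qOne_eq (p x)
  obtain ⟨w, hw⟩ := (hip (x - (u : U) • m)).mp (by rw [map_sub, map_smul, hpm, hu, sub_self])
  obtain ⟨v, hv⟩ := exists_coe_smul_qOne_eq (a⁻¹ • w)
  refine ⟨u + cBarSub χ * v, ?_⟩
  rw [AddMemClass.coe_add, add_smul, cBarSub_mul_smul_eq hma, hv, ← i.map_smul_of_tower,
    smul_inv_smul₀ ha, hw, add_sub_cancel]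

theorem equiv_of_nonsplit {M : Type*} [AddCommGroup M] [Module ℂ M] [LieRingModule Takiff M]
    [LieModule ℂ Takiff M] (i : Qchi χ →ₗ⁅ℂ,Takiff⁆ M) (p : M →ₗ⁅ℂ,Takiff⁆ Qchi χ)
    (hex : IsShortExact i p) (hns : ¬ IsSplit p) : Nonempty (M ≃ₗ⁅ℂ,Takiff⁆ UBarModSq χ) := by
  let _ := uModule M
  have := uModule_isScalarTower M
  have := uModule_isCompatible M
  obtain ⟨hi, hip, hp⟩ : Function.Injective (toULinear i) ∧
    Function.Exact (toULinear i) (toULinear p) ∧ Function.Surjective (toULinear p) := hex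
  obtain ⟨m, hm, hpm⟩ := exists_isInvariant_lift hi hip hp
  obtain ⟨a, hma⟩ := exists_cBarSub_smul_eq hi hip hm
  have ha : a ≠ 0 := by
    rintro rfl
    obtain ⟨s, hs⟩ := hm.exists_section hpm (hma.trans (zero_smul _ _))
    exact hns ⟨toLieHom s, hs⟩
  exact ⟨(toLieEquiv (hm.quotEquiv (smul_eq_zero_iff_sq_dvd hi hpm ha hma)
    (exists_coe_smul_eq_of_exact hip hpm ha hma))).symm⟩

end Uniqueness

end TakiffSl2

end

open TakiffSl2 in
theorem theorem4p18 :
    (∀ (V : Type*) [AddCommGroup V] [Module ℂ V] [LieRingModule Takiff V] [LieModule ℂ Takiff V],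
      IsHarishChandra V → LieModule.IsIrreducible ℂ Takiff V → ¬ FiniteDimensional ℂ V →
        Nonempty (CategoryTheory.Abelian.Ext (toModuleCat V) (toModuleCat V) 1 ≃ₗ[ℂ] ℂ)) ∧
    (∀ χ : ℂ, χ ≠ 0 →
      (∃ (i : Qchi χ →ₗ⁅ℂ, Takiff⁆ UBarModSq χ) (p : UBarModSq χ →ₗ⁅ℂ, Takiff⁆ Qchi χ),
        IsShortExact i p ∧ ¬ IsSplit p) ∧
      ∀ (M : Type*) [AddCommGroup M] [Module ℂ M] [LieRingModule Takiff M] [LieModule ℂ Takiff M]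
        (i : Qchi χ →ₗ⁅ℂ, Takiff⁆ M) (p : M →ₗ⁅ℂ, Takiff⁆ Qchi χ),
        IsShortExact i p → ¬ IsSplit p → Nonempty (M ≃ₗ⁅ℂ, Takiff⁆ UBarModSq χ)) := by
  refine ⟨fun V _ _ _ _ hV hirr hinf => ext_self_of_isHarishChandra V hV hirr hinf,
    fun χ _ => ⟨exists_nonsplit χ, fun M _ _ _ _ i p hex hns => equiv_of_nonsplit i p hex hns⟩⟩
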